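/- For a convex rational polytope $K\subset\mathbb R^{d}$ (the convex hull of finitely many points of $\mathbb Q^{d}$), the Ehrhart quasi-polynomial is $\mathrm{ehr}_K(x)=\sum_{i=0}^{d}c_{K,i}(x)x^i$, where $c_{K,i}:\mathbb Z\to\mathbb Q$ are the (unique) functions of finite period such that $|kK\cap\mathbb Z^{d}|=\sum_{i=0}^{d}c_{K,i}(k)k^i$ for all integers $k\ge 1$. The period sequence of $K$ is $(p_0,\dots,p_d)$, where $p_i$ is the minimum period of $c_{K,i}$. For $f,g:\mathbb Z\to\mathbb Q$ write $f\equiv g$ if $f-g$ is (the restriction to $\mathbb Z$ of) a polynomial with rational coefficients. A pyramid over $Q\subset\mathbb R^{d}$ is a set $\mathrm{conv}\big((Q\times\{0\})\cup\{a\}\big)\subset\mathbb R^{d+1}$, where $a\in\mathbb Z^{d+1}$ has last coordinate $1$; a $0$-fold pyramid over $Q$ is $Q$ itself, and an $i$-fold pyramid over $Q$, $i\ge1$, is a pyramid over an $(i-1)$-fold pyramid over $Q$. **Theorem.** Let $p\ge1$ and $n\ge2$ be integers and put $q=p^2-p+1$. Let $e_1,e_2,\dots$ denote standard basis vectors. Let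 $\ell=[-\tfrac1p,0]\subset\mathbb R$, and let $P\subset\mathbb R^2$ be the convex hull of the points $\pm q e_1$, $\pm(q-1)e_1+e_2$ and $\tfrac qp e_2$. Define $$S_n=\mathrm{conv}\{0,-\tfrac1p e_1,e_2,\dots,e_{n-1}\}\subset\mathbb R^{n-1},\qquad W_n=([-q,q]\times S_n)-q e_2\subset\mathbb R^n,$$ $$P_n=\mathrm{conv}\big((P\times\{0\}^{n-2})\cup\{e_3,\dots,e_n\}\big)\subset\mathbb R^n,\qquad H_n=\mathrm{conv}(W_n\cup P_n)\subset\mathbb R^n.$$ Then $S_n$ is an $(n-2)$-fold pyramid over $\ell$, $P_n$ is an $(n-2)$-fold pyramid over $P$, and $H_n$ is an $n$-dimensional convex rational polytope with period sequence $(1,p,1,\dots,1)$. Moreover $$\mathrm{ehr}_{H_n}(x)\equiv 2q\,x\,\mathrm{ehr}_{S_n}(x).$$ In particular, for all $p\ge1$ and $n\ge2$ there is an $n$-dimensional convex rational polytope in $\mathbb R^n$ with period sequence $(1,p,1,\dots,1)$. -/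

import Mathlib

open scoped Pointwise Polynomial

/-- A convex rational polytope in `ℝ^d`: the convex hull of finitely many points of `ℚ^d`. -/
def IsConvexRationalPolytope {d : ℕ} (K : Set (Fin d → ℝ)) : Prop :=
  ∃ V : Finset (Fin d → ℚ),
    K = convexHull ℝ ((fun (v : Fin d → ℚ) (j : Fin d) => (v j : ℝ)) '' (V : Set (Fin d → ℚ)))

/-- The dimension of (the affine span of) a nonempty subset of `ℝ^d`. -/
noncomputable def affineDim {d : ℕ} (K : Set (Fin d → ℝ)) : ℕ :=
  Module.finrank ℝ (vectorSpan ℝ K)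

/-- The number of integer lattice points in `K`. -/
noncomputable def latticeCount {d : ℕ} (K : Set (Fin d → ℝ)) : ℕ :=
  Set.ncard {z : Fin d → ℤ | (fun j => (z j : ℝ)) ∈ K}

/-- `c = (c_0, …, c_d)` are the coefficient functions of the Ehrhart quasi-polynomial of
`K ⊆ ℝ^d`: each `c_i : ℤ → ℚ` has a finite period, and
`|kK ∩ ℤ^d| = ∑ i, c_i(k) k^i` for all integers `k ≥ 1`.
These two conditions determine `c` uniquely. -/
structure IsEhrhartCoeff {d : ℕ} (K : Set (Fin d → ℝ)) (c : Fin (d + 1) → ℤ → ℚ) : Prop where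
  periodic : ∀ i, ∃ T : ℕ, 0 < T ∧ Function.Periodic (c i) (T : ℤ)
  count : ∀ k : ℕ, 1 ≤ k →
    (latticeCount ((k : ℝ) • K) : ℚ) = ∑ i : Fin (d + 1), c i (k : ℤ) * (k : ℚ) ^ (i : ℕ)

/-- `f` is the Ehrhart quasi-polynomial of `K`, as a function on `ℤ`. -/
def IsEhrhartQuasiPolynomial {d : ℕ} (K : Set (Fin d → ℝ)) (f : ℤ → ℚ) : Prop :=
  ∃ c : Fin (d + 1) → ℤ → ℚ, IsEhrhartCoeff K c ∧
    ∀ x : ℤ, f x = ∑ i : Fin (d + 1), c i x * (x : ℚ) ^ (i : ℕ)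

/-- The minimum (positive) period of `g : ℤ → ℚ` is `T`. -/
def IsMinPeriod (g : ℤ → ℚ) (T : ℕ) : Prop :=
  IsLeast {t : ℕ | 0 < t ∧ Function.Periodic g (t : ℤ)} T

/-- `K ⊆ ℝ^d` has period sequence `(s_0, …, s_d)`: `s_i` is the minimum period of the
`i`-th coefficient function of the Ehrhart quasi-polynomial of `K`. -/
def HasPeriodSequence {d : ℕ} (K : Set (Fin d → ℝ)) (s : Fin (d + 1) → ℕ) : Prop :=
  ∃ c : Fin (d + 1) → ℤ → ℚ, IsEhrhartCoeff K c ∧ ∀ i, IsMinPeriod (c i) (s i)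

/-- Equivalence of quasi-polynomials: the difference is a polynomial. -/
def EquivModPoly (f g : ℤ → ℚ) : Prop :=
  ∃ r : ℚ[X], ∀ x : ℤ, f x - g x = r.eval (x : ℚ)

/-- The convex hull of `{(x, 0) : x ∈ K} ⊆ ℝ^(d+1)` and a point `a`. -/
def coneOver {d : ℕ} (K : Set (Fin d → ℝ)) (a : Fin (d + 1) → ℝ) : Set (Fin (d + 1) → ℝ) :=
  convexHull ℝ ((fun x : Fin d → ℝ => (Fin.snoc x 0 : Fin (d + 1) → ℝ)) '' K ∪ {a})

/-- `IsFoldPyramid Q i R`: `R` is an `i`-fold pyramid over `Q`, every apex being an integer point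
with final coordinate `1`. -/
inductive IsFoldPyramid {d : ℕ} (Q : Set (Fin d → ℝ)) :
    (i : ℕ) → {e : ℕ} → Set (Fin e → ℝ) → Prop
  | base : IsFoldPyramid Q 0 Q
  | step {i e : ℕ} {R : Set (Fin e → ℝ)} (a : Fin (e + 1) → ℤ) (ha : a (Fin.last e) = 1)
      (hR : IsFoldPyramid Q i R) :
      IsFoldPyramid Q (i + 1) (coneOver R (fun j => (a j : ℝ)))

/-- `q = p² - p + 1`. -/
def qOf (p : ℕ) : ℤ := (p : ℤ) ^ 2 - (p : ℤ) + 1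

/-- The segment `ℓ = [-1/p, 0]`, in `ℝ^1`. -/
def segmentL (p : ℕ) : Set (Fin 1 → ℝ) := {x | x 0 ∈ Set.Icc (-(1 / (p : ℝ))) 0}

/-- The special pentagon: the convex hull of `± q e₁`, `± (q - 1) e₁ + e₂` and `(q / p) e₂`. -/
def pentagon (p : ℕ) : Set (Fin 2 → ℝ) :=
  convexHull ℝ {![(qOf p : ℝ), 0], ![-(qOf p : ℝ), 0], ![(qOf p : ℝ) - 1, 1],
    ![-((qOf p : ℝ) - 1), 1], ![0, (qOf p : ℝ) / (p : ℝ)]}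

/-! In the remaining definitions the ambient dimension is `n = m + 2`; the coordinate `e_k` of the
mathematics is the coordinate with index `k - 1` of `Fin n`. -/

/-- `S_n = conv {0, -(1/p) e₁, e₂, …, e_{n-1}} ⊆ ℝ^(n-1)`, with `n = m + 2`. -/
def simplexS (p m : ℕ) : Set (Fin (m + 1) → ℝ) :=
  convexHull ℝ ({0, Pi.single 0 (-(1 / (p : ℝ)))} ∪
    (fun k : Fin (m + 1) => (Pi.single k 1 : Fin (m + 1) → ℝ)) '' {k | k ≠ 0})

/-- `W_n = ([-q, q] × S_n) - q e₂ ⊆ ℝ^n`, with `n = m + 2`. -/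
def prismW (p m : ℕ) : Set (Fin (m + 2) → ℝ) :=
  (fun x : Fin (m + 2) → ℝ => x - Pi.single 1 (qOf p : ℝ)) ''
    {x | x 0 ∈ Set.Icc (-(qOf p : ℝ)) (qOf p : ℝ) ∧ Fin.tail x ∈ simplexS p m}

/-- The copy `P' = {(x, 0, …, 0) : x ∈ P} ⊆ ℝ^n` of the pentagon, with `n = m + 2`. -/
def pentagonEmbedded (p m : ℕ) : Set (Fin (m + 2) → ℝ) :=
  (fun (v : Fin 2 → ℝ) (j : Fin (m + 2)) =>
    if h : (j : ℕ) < 2 then v ⟨(j : ℕ), h⟩ else 0) '' pentagon p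

/-- `P_n = conv (P' ∪ {e₃, …, e_n}) ⊆ ℝ^n`, with `n = m + 2`. -/
def pyramidP (p m : ℕ) : Set (Fin (m + 2) → ℝ) :=
  convexHull ℝ (pentagonEmbedded p m ∪
    (fun k : Fin (m + 2) => (Pi.single k 1 : Fin (m + 2) → ℝ)) '' {k | 2 ≤ (k : ℕ)})

/-- `H_n = conv (W_n ∪ P_n) ⊆ ℝ^n`, with `n = m + 2`. -/
def polytopeH (p m : ℕ) : Set (Fin (m + 2) → ℝ) :=
  convexHull ℝ (prismW p m ∪ pyramidP p m)

/-! Slice `k • H_n` by its last `n - 2` coordinates `z`, a nonnegative integer vector with `∑ z ≤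
k`. The planar fibre depends, for fixed `k`, only on `j = k - ∑ z`; it is `sliceH p k j`. The dilate
`k • S_n` fibres over the same vectors `z`, with fibre the `⌊j/p⌋ + 1` integers of `[-j/p, 0]`. So
both lattice counts are `(n-2)`-fold iterated partial sums over `j` of the fibre counts
(`ncard_simplex_fibration`).

The heart is the planar count `finite_and_ncard_sliceH`. At the bottom, `⌊j/p⌋` rows of `2qk + 1`
points contribute `(2qk + 1)⌊j/p⌋`. At the top, the tip of the pentagon has height `qj/p = (p-1)j +
j/p`, so its count also involves `⌊j/p⌋`; for `q = p² - p + 1` the terms in `⌊j/p⌋²` and `j⌊j/p⌋`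
cancel and exactly `-⌊j/p⌋` remains. The slice therefore has `2qk(⌊j/p⌋ + 1)` points up to a
polynomial in `k` and `j`. Summation is over `j` with `k` fixed, so the factor `2qk` comes out of
the sums, which gives the equivalence with `2qx ehr_{S_n}(x)`.

For the periods, `exists_iterSum_floor` writes the iterated sums of `⌊j/p⌋ + 1` as a polynomial plus
a function of minimum period `p`. Only the constant coefficient of `ehr_{S_n}` varies, and
multiplication by `2qx` moves this variation to the linear coefficient of `ehr_{H_n}`.

The fibration needs `H_n` in terms of inequalities (`polytopeH_eq`). The hard inclusion,
`Convex.hrepH_subset`, cuts at the heights `-q` and `0` of the second coordinate: below lies the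
prism, above the pyramid, and a point in between is placed on a segment joining the two. -/

/-! ### Iterated partial sums of polynomials and of `⌊j/p⌋ + 1` -/

/-- The `m`-fold iterated partial sums of `f`. -/
def iterSum : ℕ → (ℕ → ℚ) → ℕ → ℚ
  | 0, f => f
  | m + 1, f => fun k => ∑ j ∈ Finset.range (k + 1), iterSum m f j

theorem iterSum_congr {f g : ℕ → ℚ} (m : ℕ) {k : ℕ} (h : ∀ j ≤ k, f j = g j) :
    iterSum m f k = iterSum m g k := by
  induction m generalizing k with
  | zero => exact h k le_rfl
  | succ m ih =>
    refine Finset.sum_congr rfl fun j hj => ih fun i hi => h i ?_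
    have := Finset.mem_range.mp hj
    omega

theorem iterSum_add (m : ℕ) (f g : ℕ → ℚ) (k : ℕ) :
    iterSum m (fun j => f j + g j) k = iterSum m f k + iterSum m g k := by
  induction m generalizing k with
  | zero => rfl
  | succ m ih => simp only [iterSum, ih, Finset.sum_add_distrib]

theorem iterSum_const_mul (m : ℕ) (a : ℚ) (f : ℕ → ℚ) (k : ℕ) :
    iterSum m (fun j => a * f j) k = a * iterSum m f k := by
  induction m generalizing k with
  | zero => rfl
  | succ m ih => simp only [iterSum, ih, Finset.mul_sum]

theorem exists_polynomial_sum_range_pow (n : ℕ) :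
    ∃ R : ℚ[X], R.natDegree ≤ n + 1 ∧
      ∀ k : ℕ, ∑ j ∈ Finset.range (k + 1), (j : ℚ) ^ n = R.eval (k : ℚ) := by
  refine ⟨Polynomial.X ^ n + ∑ i ∈ Finset.range (n + 1),
    Polynomial.C (bernoulli i * (n + 1).choose i / (n + 1)) * Polynomial.X ^ (n + 1 - i), ?_, ?_⟩
  · refine Polynomial.natDegree_add_le_of_degree_le ?_ ?_
    · exact (Polynomial.natDegree_X_pow_le n).trans (Nat.le_succ n)
    · refine Polynomial.natDegree_sum_le_of_forall_le _ _ fun i _ => ?_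
      exact (Polynomial.natDegree_C_mul_X_pow_le _ _).trans (Nat.sub_le _ _)
  · intro k
    rw [Finset.sum_range_succ, sum_range_pow, Polynomial.eval_add, Polynomial.eval_finsetSum,
      add_comm]
    congr 1
    · simp
    · refine Finset.sum_congr rfl fun i _ => ?_
      simp only [Polynomial.eval_mul, Polynomial.eval_C, Polynomial.eval_pow, Polynomial.eval_X]
      ring

theorem exists_polynomial_sum_range (r : ℚ[X]) {d : ℕ} (hr : r.natDegree ≤ d) :
    ∃ R : ℚ[X], R.natDegree ≤ d + 1 ∧
      ∀ k : ℕ, ∑ j ∈ Finset.range (k + 1), r.eval (j : ℚ) = R.eval (k : ℚ) := by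
  choose S hS hS' using exists_polynomial_sum_range_pow
  refine ⟨∑ i ∈ Finset.range (d + 1), Polynomial.C (r.coeff i) * S i, ?_, fun k => ?_⟩
  · refine Polynomial.natDegree_sum_le_of_forall_le _ _ fun i hi => ?_
    have := Finset.mem_range.mp hi
    exact (Polynomial.natDegree_C_mul_le _ _).trans ((hS i).trans (by omega))
  · simp only [Polynomial.eval_eq_sum_range' (Nat.lt_succ_of_le hr), Polynomial.eval_finsetSum,
      Polynomial.eval_mul, Polynomial.eval_C, ← hS', Finset.mul_sum]
    exact Finset.sum_comm

theorem exists_polynomial_iterSum (m : ℕ) (r : ℚ[X]) {d : ℕ} (hr : r.natDegree ≤ d) :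
    ∃ R : ℚ[X], R.natDegree ≤ d + m ∧
      ∀ k : ℕ, iterSum m (fun j => r.eval (j : ℚ)) k = R.eval (k : ℚ) := by
  induction m with
  | zero => exact ⟨r, hr, fun k => rfl⟩
  | succ m ih =>
    obtain ⟨R, hR, hRe⟩ := ih
    obtain ⟨R', hR', hRe'⟩ := exists_polynomial_sum_range R hR
    exact ⟨R', hR', fun k => by simp only [iterSum, hRe, hRe']⟩

/-- A periodic function is, up to its mean, the difference of a periodic function. -/
theorem exists_periodic_antidifference {p : ℕ} (hp : 0 < p) {h : ℤ → ℚ}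
    (hh : Function.Periodic h (p : ℤ)) :
    ∃ (h' : ℤ → ℚ) (μ : ℚ), Function.Periodic h' (p : ℤ) ∧
      ∀ x, h' (x + 1) - h' x = h (x + 1) - μ := by
  have hp' : (p : ℚ) ≠ 0 := by positivity
  let M : ℤ → ℚ := fun x => ∑ i ∈ Finset.range p, h (x + 1 + i)
  have hM1 : ∀ x, M (x + 1) = M x := by
    intro x
    have h1 := Finset.sum_range_succ (fun i : ℕ => h (x + 1 + i)) p
    rw [Finset.sum_range_succ'] at h1
    have h2 : h (x + 1 + (p : ℕ)) = h (x + 1 + (0 : ℕ)) := by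
      rw [hh]; simp
    have h3 : ∑ i ∈ Finset.range p, h (x + 1 + ((i + 1 : ℕ) : ℤ)) = M (x + 1) :=
      Finset.sum_congr rfl fun i _ => by congr 1; push_cast; ring
    rw [h3, h2] at h1
    exact add_right_cancel h1
  have hM : ∀ x, M x = M 0 := by
    intro x
    have : Function.Periodic M 1 := hM1
    simpa using this.int_mul_eq x
  -- Shifting `x` by one lowers each weight `i` by one, which subtracts the sum over a full period;
  -- the wrap-around term adds `p * h (x + 1)`. Dividing by `p` leaves `h` minus its mean.
  refine ⟨fun x => (∑ i ∈ Finset.range p, (i : ℚ) * h (x + 1 + i)) / p, M 0 / p, ?_, ?_⟩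
  · intro x
    refine congrArg (· / (p : ℚ)) (Finset.sum_congr rfl fun i _ => ?_)
    rw [show x + (p : ℤ) + 1 + i = x + 1 + i + p by ring, hh]
  · intro x
    have h1 := Finset.sum_range_succ (fun i : ℕ => ((i : ℚ) - 1) * h (x + 1 + i)) p
    rw [Finset.sum_range_succ'] at h1
    have h3 : ∑ i ∈ Finset.range p, (((i + 1 : ℕ) : ℚ) - 1) * h (x + 1 + ((i + 1 : ℕ) : ℤ)) =
        ∑ i ∈ Finset.range p, (i : ℚ) * h (x + 1 + 1 + i) := by
      refine Finset.sum_congr rfl fun i _ => ?_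
      rw [show x + 1 + ((i + 1 : ℕ) : ℤ) = x + 1 + 1 + i by push_cast; ring]
      push_cast; ring
    have h4 : ∑ i ∈ Finset.range p, ((i : ℚ) - 1) * h (x + 1 + i) =
        ∑ i ∈ Finset.range p, (i : ℚ) * h (x + 1 + i) - M 0 := by
      rw [← hM x, ← Finset.sum_sub_distrib]
      exact Finset.sum_congr rfl fun i _ => by ring
    rw [h3, h4, hh] at h1
    simp only [Nat.cast_zero, add_zero] at h1
    field_simp
    linarith

/-- The sum telescopes from `-1`, because the term `h 0` is the increment of `h'` from `-1` to `0`.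
-/
theorem sum_range_eq_of_antidifference {h h' : ℤ → ℚ} {μ : ℚ}
    (hd : ∀ x, h' (x + 1) - h' x = h (x + 1) - μ) (k : ℕ) :
    ∑ j ∈ Finset.range (k + 1), h j = μ * k + (μ - h' (-1)) + h' k := by
  induction k with
  | zero => have := hd (-1); simp at this ⊢; linarith
  | succ k ih =>
    rw [Finset.sum_range_succ, ih]
    have := hd k
    push_cast
    linarith

/-- The iterated partial sums of `⌊j / p⌋ + 1` are a polynomial plus a function of minimum
period `p`. -/
theorem exists_iterSum_floor (p : ℕ) (hp : 0 < p) (m : ℕ) :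
    ∃ (r : ℚ[X]) (h : ℤ → ℚ), r.natDegree ≤ m + 1 ∧ IsMinPeriod h p ∧
      ∀ k : ℕ, iterSum m (fun j => ((j / p : ℕ) : ℚ) + 1) k = r.eval (k : ℚ) + h k := by
  have hp' : (p : ℚ) ≠ 0 := by positivity
  induction m with
  | zero =>
    refine ⟨Polynomial.C (1 / (p : ℚ)) * Polynomial.X + Polynomial.C 1,
      fun x => -((x % (p : ℤ) : ℤ) : ℚ) / p, ?_, ⟨⟨hp, fun x => by simp⟩, ?_⟩, fun k => ?_⟩
    · exact Polynomial.natDegree_linear_le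
    -- The sawtooth vanishes only at multiples of `p`, so any period is a multiple of `p`.
    · rintro t ⟨ht, hper⟩
      have h0 := hper 0
      simp only [zero_add, Int.zero_emod, Int.cast_zero, neg_zero, zero_div, div_eq_zero_iff,
        neg_eq_zero, Int.cast_eq_zero, hp', or_false] at h0
      exact Nat.le_of_dvd ht (by exact_mod_cast Int.dvd_of_emod_eq_zero h0)
    · have h1 : (p : ℚ) * ((k / p : ℕ) : ℚ) + ((k % p : ℕ) : ℚ) = k := by
        exact_mod_cast Nat.div_add_mod k p
      have h2 : (((k : ℤ) % (p : ℤ) : ℤ) : ℚ) = ((k % p : ℕ) : ℚ) := by norm_cast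
      simp only [iterSum, Polynomial.eval_add, Polynomial.eval_mul, Polynomial.eval_C,
        Polynomial.eval_X, h2]
      field_simp
      linarith
  | succ m ih =>
    obtain ⟨r, h, hr, ⟨⟨-, hper⟩, hmin⟩, heq⟩ := ih
    obtain ⟨h', μ, hper', hd⟩ := exists_periodic_antidifference hp hper
    obtain ⟨R, hR, hRe⟩ := exists_polynomial_sum_range r hr
    refine ⟨R + (Polynomial.C μ * Polynomial.X + Polynomial.C (μ - h' (-1))), h', ?_,
      ⟨⟨hp, hper'⟩, ?_⟩, fun k => ?_⟩
    · exact Polynomial.natDegree_add_le_of_degree_le hR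
        (Polynomial.natDegree_linear_le.trans (by omega))
    -- A period of `h'` is a period of its difference `h - μ`, so summation cannot shorten the
    -- minimum period.
    · rintro t ⟨ht, hpt⟩
      refine hmin ⟨ht, fun x => ?_⟩
      have h1 := hd (x - 1)
      have h2 := hd (x - 1 + t)
      rw [hpt, show x - 1 + (t : ℤ) + 1 = x - 1 + 1 + t by ring, hpt] at h2
      rw [sub_add_cancel] at h1 h2
      linarith
    · simp only [iterSum, heq, Finset.sum_add_distrib, hRe, sum_range_eq_of_antidifference hd]
      simp
      ring

/-! ### Lattice points fibred over a dilated simplex -/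

/-- Counting points over the simplex `{z ≥ 0, ∑ z ≤ k}` whose fibre depends on `k - ∑ z` only. -/
theorem ncard_simplex_fibration {α : Type*} {B : ℕ → Set α} (hB : ∀ j, (B j).Finite) (m k : ℕ) :
    {v : (Fin m → ℕ) × α | ∑ i, v.1 i ≤ k ∧ v.2 ∈ B (k - ∑ i, v.1 i)}.Finite ∧
    (Set.ncard {v : (Fin m → ℕ) × α | ∑ i, v.1 i ≤ k ∧ v.2 ∈ B (k - ∑ i, v.1 i)} : ℚ) =
      iterSum m (fun j => ((B j).ncard : ℚ)) k := by
  induction m generalizing k with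
  | zero =>
    have : {v : (Fin 0 → ℕ) × α | ∑ i, v.1 i ≤ k ∧ v.2 ∈ B (k - ∑ i, v.1 i)} =
        (fun a => (Fin.elim0, a)) '' B k := by
      ext ⟨z, a⟩
      simp [Subsingleton.elim z Fin.elim0]
    rw [this]
    refine ⟨(hB k).image _, ?_⟩
    rw [Set.ncard_image_of_injective _ (Prod.mk_right_injective _)]
    rfl
  | succ m ih =>
    set D : ℕ → Set ((Fin m → ℕ) × α) := fun k =>
      {v | ∑ i, v.1 i ≤ k ∧ v.2 ∈ B (k - ∑ i, v.1 i)} with hD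
    let F : ℕ → (Fin m → ℕ) × α → (Fin (m + 1) → ℕ) × α := fun i v => (Fin.cons i v.1, v.2)
    have hF : ∀ i, Function.Injective (F i) := by
      rintro i ⟨z, a⟩ ⟨z', a'⟩ h
      simp only [F, Prod.mk.injEq, Fin.cons_inj, true_and] at h
      simp [h]
    have hU : {v : (Fin (m + 1) → ℕ) × α | ∑ i, v.1 i ≤ k ∧ v.2 ∈ B (k - ∑ i, v.1 i)} =
        ⋃ i ∈ Finset.range (k + 1), F i '' D (k - i) := by
      ext ⟨z, a⟩
      simp only [Set.mem_ofPred_eq, Set.mem_iUnion, Finset.mem_range, Set.mem_image, hD, F,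
        Prod.mk.injEq, Prod.exists, exists_prop, Fin.sum_univ_succ]
      constructor
      · rintro ⟨h1, h2⟩
        refine ⟨z 0, by omega, Fin.tail z, a, ⟨?_, ?_⟩, Fin.cons_self_tail z, rfl⟩
        · simp only [Fin.tail]; omega
        · simpa only [Fin.tail, Nat.sub_sub] using h2
      · rintro ⟨i, hi, z', a', ⟨h1, h2⟩, rfl, rfl⟩
        simp only [Fin.cons_zero, Fin.cons_succ]
        exact ⟨by omega, by rwa [← Nat.sub_sub]⟩
    have hdis : ((Finset.range (k + 1) : Finset ℕ) : Set ℕ).PairwiseDisjoint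
        fun i => F i '' D (k - i) := by
      intro i _ j _ hij
      refine Set.disjoint_left.mpr ?_
      rintro _ ⟨v, _, rfl⟩ ⟨w, _, hw⟩
      apply hij
      have := congrArg (fun u : (Fin (m + 1) → ℕ) × α => u.1 0) hw
      simpa [F] using this.symm
    have hfin : ∀ i, (F i '' D (k - i)).Finite := fun i => (ih (k - i)).1.image _
    rw [hU]
    refine ⟨Set.Finite.biUnion (Finset.finite_toSet _) fun i _ => hfin i, ?_⟩
    have hcard : Set.ncard (⋃ i ∈ Finset.range (k + 1), F i '' D (k - i)) =
        ∑ i ∈ Finset.range (k + 1), (D (k - i)).ncard := by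
      have := Set.Finite.ncard_biUnion (Finset.finite_toSet (Finset.range (k + 1)))
        (fun i _ => hfin i) hdis
      simp only [Finset.mem_coe] at this
      rw [this, finsum_mem_finset_eq_sum]
      exact Finset.sum_congr rfl fun i _ => Set.ncard_image_of_injective _ (hF i)
    rw [hcard]
    push_cast
    simp only [hD, (ih _).2, iterSum]
    -- Fixing the first coordinate `i` leaves the problem for `k - i`; reversing the order of
    -- summation turns this into a partial sum.
    exact Finset.sum_flip (fun j => iterSum m (fun j => ((B j).ncard : ℚ)) j)

/-! ### Counting a planar slice row by row -/

theorem finite_and_ncard_strips (Y : Finset ℤ) (w : ℤ → ℤ) (hw : ∀ y ∈ Y, 0 ≤ w y) :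
    {v : ℤ × ℤ | v.2 ∈ Y ∧ |v.1| ≤ w v.2}.Finite ∧
    (Set.ncard {v : ℤ × ℤ | v.2 ∈ Y ∧ |v.1| ≤ w v.2} : ℤ) = ∑ y ∈ Y, (2 * w y + 1) := by
  have hU : {v : ℤ × ℤ | v.2 ∈ Y ∧ |v.1| ≤ w v.2} =
      ((Y.biUnion fun y => (Finset.Icc (-w y) (w y)).image fun x => (x, y) :
        Finset (ℤ × ℤ)) : Set (ℤ × ℤ)) := by
    ext ⟨x, y⟩
    simp only [Set.mem_ofPred_eq, abs_le, Finset.coe_biUnion, Finset.mem_coe, Finset.coe_image,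
      Finset.coe_Icc, Set.mem_iUnion, Set.mem_image, Set.mem_Icc, Prod.mk.injEq, exists_prop]
    constructor
    · rintro ⟨h1, h2⟩
      exact ⟨y, h1, x, h2, rfl, rfl⟩
    · rintro ⟨_, h1, _, h2, rfl, rfl⟩
      exact ⟨h1, h2⟩
  rw [hU]
  refine ⟨Finset.finite_toSet _, ?_⟩
  rw [Set.ncard_coe_finset, Finset.card_biUnion]
  · push_cast
    refine Finset.sum_congr rfl fun y hy => ?_
    rw [Finset.card_image_of_injective _ (Prod.mk_left_injective _), Int.card_Icc]
    have := hw y hy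
    omega
  · intro y _ y' _ hyy'
    refine Finset.disjoint_left.mpr ?_
    simp only [Finset.mem_image, not_exists, not_and]
    rintro _ ⟨x, _, rfl⟩ x' _ h
    exact hyy' (Prod.mk.inj h).2.symm

theorem Int.sum_Ico_eq_sub {a b : ℤ} (hab : a ≤ b) (F f : ℤ → ℤ)
    (h : ∀ y, a ≤ y → y < b → f y = F (y + 1) - F y) :
    ∑ y ∈ Finset.Ico a b, f y = F b - F a := by
  induction b, hab using Int.leInduction with
  | base => simp
  | succ b hab ih =>
    have h1 : Finset.Ico a (b + 1) = insert b (Finset.Ico a b) := by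
      ext y; simp only [Finset.mem_Ico, Finset.mem_insert]; omega
    rw [h1, Finset.sum_insert (by simp), ih fun y h1 h2 => h y h1 (by omega),
      h b hab (by omega)]
    ring

/-- Twice the sum of `⌈i / P⌉` over `1 ≤ i ≤ t`. -/
def ceilSum (P t : ℤ) : ℤ := -((-t) / P) * (2 * t + P + P * ((-t) / P))

/-- Here `c` is `⌈t/P⌉`, but the expressions for `c` and `c - 1` agree at the breakpoint `t =
P(c-1)`, so both ends of the range may be closed. This tolerance is needed when the formula is
evaluated at the tip of the slice. -/
theorem ceilSum_eq {P t c : ℤ} (hP : 0 < P) (h1 : P * (c - 1) ≤ t) (h2 : t ≤ P * c) :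
    ceilSum P t = c * (2 * t + P - P * c) := by
  rcases h1.eq_or_lt with h1 | h1
  · have : (-t) / P = -(c - 1) := by
      rw [← h1, ← mul_neg, Int.mul_ediv_cancel_left _ hP.ne']
    rw [ceilSum, this, ← h1]; ring
  · have : (-t) / P = -c := by
      rw [Int.ediv_eq_iff_of_pos hP]
      constructor <;> nlinarith
    rw [ceilSum, this]; ring

theorem ceilSum_succ {P : ℤ} (hP : 0 < P) (t : ℤ) :
    ceilSum P (t + 1) = ceilSum P t - 2 * ((-(t + 1)) / P) := by
  obtain ⟨c, hc⟩ : ∃ c, (-(t + 1)) / P = -c := ⟨_, (neg_neg _).symm⟩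
  have hc' := (Int.ediv_eq_iff_of_pos hP).mp hc
  have h1 : P * (c - 1) ≤ t := by nlinarith [hc'.1, hc'.2]
  have h2 : t + 1 ≤ P * c := by nlinarith [hc'.1, hc'.2]
  rw [hc, ceilSum_eq hP h1 (by omega), ceilSum_eq hP (by omega) h2]
  ring

/-- The lattice points of a horizontal slice of the `k`-th dilate of the polytope `H_n`. -/
def sliceH (p : ℕ) (k j : ℤ) : Set (ℤ × ℤ) :=
  {v | |v.1| ≤ qOf p * k ∧ -j ≤ p * (v.2 + qOf p * k) ∧ |v.1| + v.2 ≤ qOf p * j ∧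
    (p - 1) * |v.1| + p ^ 2 * v.2 ≤ p * qOf p * j}

theorem one_le_qOf {p : ℕ} (hp : 1 ≤ p) : 1 ≤ qOf p := by
  have : (1 : ℤ) ≤ p := by exact_mod_cast hp
  unfold qOf
  nlinarith

/-- Half-widths of the horizontal strips of `sliceH`. -/
noncomputable def sliceWidth (p : ℕ) (k j y : ℤ) : ℤ :=
  if y < -(qOf p * (k - j)) then qOf p * k else if y ≤ j then qOf p * j - y
  else (p * qOf p * j - p ^ 2 * y) / (p - 1)

/-- Heights of the horizontal strips of `sliceH`. -/
noncomputable def sliceHeights (p : ℕ) (k j : ℤ) : Finset ℤ :=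
  Finset.Ico (-(qOf p * k) - j / p) (-(qOf p * (k - j))) ∪
    (Finset.Ico (-(qOf p * (k - j))) (j + 1) ∪
      Finset.Ico (j + 1) (j + 1 + ((p - 2) * j + j / p)))

/-- The binding bound on `|x|` changes at two integer heights: `|x| ≤ qk` meets `|x| + y ≤ qj` at `y
= -q(k-j)`, and the latter meets the last inequality at `y = j`, because `(p-1)(qj - y) + p²y =
(p-1)qj + qy`. The extreme rows are `-qk - ⌊j/p⌋` and `(p-1)j + ⌊j/p⌋`. -/
theorem sliceH_eq {p : ℕ} (hp : 1 ≤ p) {k j : ℤ} (hj : 0 ≤ j) (hjk : j ≤ k) :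
    sliceH p k j = {v | v.2 ∈ sliceHeights p k j ∧ |v.1| ≤ sliceWidth p k j v.2} := by
  have hp1 : (1 : ℤ) ≤ p := by exact_mod_cast hp
  have hq1 := one_le_qOf hp
  have hq : qOf p = (p : ℤ) ^ 2 - p + 1 := rfl
  ext ⟨x, y⟩
  simp only [sliceH, sliceHeights, sliceWidth, Set.mem_ofPred_eq, Finset.mem_union, Finset.mem_Ico]
  generalize qOf p = q at *
  generalize (p : ℤ) = p at *
  obtain ⟨a, ha⟩ : ∃ a, j / p = a := ⟨_, rfl⟩
  have hX := abs_nonneg x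
  generalize |x| = X at *
  have hfl : ∀ t, p * t ≤ j ↔ t ≤ a := fun t => by
    rw [← ha, Int.le_ediv_iff_mul_le (by omega), mul_comm]
  have ha0 : 0 ≤ a := (hfl 0).1 (by omega)
  rw [ha]
  have hqj : 0 ≤ q * j := by positivity
  have hqkj : 0 ≤ q * (k - j) := mul_nonneg (by omega) (by omega)
  have hqk : q * (k - j) = q * k - q * j := by ring
  have hM : 0 ≤ (p - 2) * j + a := by
    have := (hfl ((2 - p) * j)).2
    have h2 : p * ((2 - p) * j) ≤ j := by nlinarith [mul_nonneg (sq_nonneg (p - 1)) hj]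
    have := (hfl _).1 h2
    linarith
  have hbot : -j ≤ p * (y + q * k) ↔ -(q * k) - a ≤ y := by
    have := hfl (-(y + q * k))
    rw [mul_neg] at this
    constructor
    · intro h; have := this.1 (by linarith); linarith
    · intro h; have := this.2 (by linarith); linarith
  rw [hbot]
  have hle : ∀ y ≤ j, X + y ≤ q * j → (p - 1) * X + p ^ 2 * y ≤ p * q * j := by
    intro y hy h
    have h1 := mul_le_mul_of_nonneg_left h (show 0 ≤ p - 1 by omega)
    have h2 := mul_le_mul_of_nonneg_left hy (show 0 ≤ q by omega)
    subst hq
    linarith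
  by_cases h1 : y < -(q * (k - j))
  · simp only [h1, if_true]
    constructor
    · rintro ⟨h2, h3, -, -⟩
      exact ⟨Or.inl ⟨h3, trivial⟩, h2⟩
    · rintro ⟨h2, h3⟩
      have h4 : -(q * k) - a ≤ y := by omega
      exact ⟨h3, h4, by omega, hle y (by omega) (by omega)⟩
  · by_cases h2 : y ≤ j
    · simp only [h1, h2, if_true, if_false]
      constructor
      · rintro ⟨-, -, h3, -⟩
        exact ⟨Or.inr (Or.inl ⟨by omega, by omega⟩), by omega⟩
      · rintro ⟨-, h3⟩
        exact ⟨by omega, by omega, by omega, hle y h2 (by omega)⟩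
    · simp only [h1, h2, if_false]
      push Not at h1 h2
      constructor
      · rintro ⟨-, -, -, h3⟩
        -- For `p = 1` the last inequality reads `y ≤ j`, so there are no rows above `j`.
        have hp2 : 0 < p - 1 := by
          by_contra hcon
          have : p = 1 := by omega
          subst this
          subst hq
          linarith
        refine ⟨Or.inr (Or.inr ⟨by omega, ?_⟩), ?_⟩
        · have h4 : p * (p * y) ≤ p * (q * j) := by
            have := mul_nonneg hp2.le hX
            linarith
          have h5 := le_of_mul_le_mul_left h4 (by omega)
          have h6 := (hfl (y - (p - 1) * j)).1 (by subst hq; linarith)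
          linarith
        · rw [Int.le_ediv_iff_mul_le hp2]
          linarith
      · rintro ⟨h3, h4⟩
        have hp2 : 0 < p - 1 := by
          by_contra hcon
          have hp1' : p = 1 := by omega
          rw [hp1', Int.ediv_one] at ha
          have h5 : (p - 2) * j + a = 0 := by rw [← ha, hp1']; ring
          rcases h3 with h3 | h3 | h3
          · exact h3.2.elim
          · omega
          · linarith [h3.1, h3.2]
        rw [Int.le_ediv_iff_mul_le hp2] at h4
        have h5 : X + y ≤ q * j := by
          have h6 : (p - 1) * (X + y) ≤ (p - 1) * (q * j) := by
            have h2' := mul_le_mul_of_nonneg_left h2.le (show 0 ≤ q by omega)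
            subst hq
            linarith
          exact le_of_mul_le_mul_left h6 hp2
        have hqk0 : q * j ≤ q * k := mul_le_mul_of_nonneg_left hjk (by omega)
        exact ⟨by omega, by omega, h5, by linarith⟩

/-- The three ranges of rows are summed by telescoping. The only surviving non-polynomial term is
`2qk⌊j/p⌋`: the extra `⌊j/p⌋` from the bottom rows cancels against the tip, whose quadratic and
mixed terms in `⌊j/p⌋` cancel among themselves. -/
theorem finite_and_ncard_sliceH {p : ℕ} (hp : 1 ≤ p) {k j : ℤ} (hj : 0 ≤ j) (hjk : j ≤ k) :
    (sliceH p k j).Finite ∧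
    ((sliceH p k j).ncard : ℤ) = 2 * qOf p * k * (j / p) + 2 * qOf p ^ 2 * k * j + qOf p * j +
      (qOf p * k + 1) ^ 2 + (2 * p * (p - 1) * (p - 2) - (p + 1) * (p - 2) ^ 2 - (p - 3) -
        (qOf p - 1) ^ 2) * j ^ 2 + (-(p * (p - 2)) - (p - 1)) * j := by
  have hp1 : (1 : ℤ) ≤ p := by exact_mod_cast hp
  have hq1 := one_le_qOf hp
  have hq : qOf p = (p : ℤ) ^ 2 - p + 1 := rfl
  have hqk : qOf p * (k - j) = qOf p * k - qOf p * j := by ring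
  have hqkj : 0 ≤ qOf p * (k - j) := mul_nonneg (by omega) (by omega)
  have hqj : 0 ≤ qOf p * j := by positivity
  have hqj' : j ≤ qOf p * j := le_mul_of_one_le_left hj hq1
  have ha0 : 0 ≤ j / p := Int.ediv_nonneg hj (by omega)
  have haj := Int.mul_ediv_add_emod j p
  have hb0 := Int.emod_nonneg j (show (p : ℤ) ≠ 0 by omega)
  have hb1 := Int.emod_lt_of_pos j (show 0 < (p : ℤ) by omega)
  have hM : 0 ≤ ((p : ℤ) - 2) * j + j / p := by
    have : (p : ℤ) * -(((p : ℤ) - 2) * j + j / p) ≤ 0 + (p - 1) := by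
      nlinarith [mul_nonneg (sq_nonneg ((p : ℤ) - 1)) hj]
    by_contra hcon
    nlinarith
  rw [sliceH_eq hp hj hjk]
  have hw : ∀ y ∈ sliceHeights p k j, 0 ≤ sliceWidth p k j y := by
    intro y hy
    simp only [sliceHeights, Finset.mem_union, Finset.mem_Ico] at hy
    rw [sliceWidth]
    split_ifs with h1 h2
    · omega
    · omega
    · refine Int.ediv_nonneg ?_ (by omega)
      have h3 : y ≤ (p - 1) * j + j / p := by
        rcases hy with hy | hy | hy
        · omega
        · omega
        · linarith [hy.2]
      have h4 := mul_le_mul_of_nonneg_left h3 (show (0 : ℤ) ≤ p by omega)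
      have h5 : (p : ℤ) * y ≤ qOf p * j := by rw [hq]; linarith
      have h6 := mul_le_mul_of_nonneg_left h5 (show (0 : ℤ) ≤ p by omega)
      linarith
  refine ⟨(finite_and_ncard_strips _ _ hw).1, ?_⟩
  rw [(finite_and_ncard_strips _ _ hw).2, sliceHeights, Finset.sum_union, Finset.sum_union]
  · have s1 : ∑ y ∈ Finset.Ico (-(qOf p * k) - j / p) (-(qOf p * (k - j))),
        (2 * sliceWidth p k j y + 1) = (qOf p * j + j / p) * (2 * (qOf p * k) + 1) := by
      rw [Int.sum_Ico_eq_sub (by omega) (fun y => (2 * (qOf p * k) + 1) * y)]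
      · ring
      · intro y _ h
        rw [sliceWidth, if_pos h]; ring
    have s2 : ∑ y ∈ Finset.Ico (-(qOf p * (k - j))) (j + 1),
        (2 * sliceWidth p k j y + 1) = (qOf p * k + 1) ^ 2 - (qOf p * j - j) ^ 2 := by
      rw [Int.sum_Ico_eq_sub (by omega) (fun y => -(qOf p * j - y + 1) ^ 2)]
      · ring
      · intro y h h'
        rw [sliceWidth, if_neg (by omega), if_pos (by omega)]; ring
    have s3 : ∑ y ∈ Finset.Ico (j + 1) (j + 1 + ((p - 2) * j + j / p)),
        (2 * sliceWidth p k j y + 1) =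
        2 * p * (p - 1) * j * ((p - 2) * j + j / p) -
          (p + 1) * ((p - 2) * j + j / p) * ((p - 2) * j + j / p + 1) + ((p - 2) * j + j / p)
          - (j - j / p) * (2 * ((p - 2) * j + j / p) + (p - 1) - (p - 1) * (j - j / p)) := by
      rcases hp1.eq_or_lt with hp2 | hp2
      · rw [← hp2]; simp
      · have hP : 0 < (p : ℤ) - 1 := by omega
        rw [Int.sum_Ico_eq_sub (by omega) (fun y => 2 * p * (p - 1) * j * (y - (j + 1)) -
          (p + 1) * (y - (j + 1)) * (y - (j + 1) + 1) + (y - (j + 1)) -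
            ceilSum (p - 1) (y - (j + 1)))]
        · have h0 : ceilSum (p - 1) (j + 1 - (j + 1)) = 0 := by
            rw [ceilSum_eq (c := 0) hP] <;> simp
            omega
          -- The tip has `t = (p-2)j + ⌊j/p⌋` rows, and `c = j - ⌊j/p⌋` satisfies `(p-1)(c-1) ≤ t ≤
          -- (p-1)c` since `0 ≤ j - p⌊j/p⌋ ≤ p - 1`. The left inequality can be an equality.
          have h1 : ceilSum (p - 1) (j + 1 + ((p - 2) * j + j / p) - (j + 1)) =
              (j - j / p) * (2 * ((p - 2) * j + j / p) + (p - 1) - (p - 1) * (j - j / p)) := by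
            rw [ceilSum_eq (c := j - j / p) hP]
            · ring
            · linarith
            · linarith
          rw [h0, h1]
          ring
        · intro y h h'
          rw [sliceWidth, if_neg (by omega), if_neg (by omega),
            show y + 1 - (j + 1) = y - (j + 1) + 1 by ring, ceilSum_succ hP]
          -- Extracting the multiple of `p - 1` leaves `-⌈(y - j)/(p - 1)⌉`, the summand of
          -- `ceilSum`.
          have : ((p : ℤ) * qOf p * j - p ^ 2 * y) / (p - 1) =
              p * (p - 1) * j - (p + 1) * (y - j) + (-(y - (j + 1) + 1)) / (p - 1) := by
            rw [hq, ← Int.mul_add_ediv_left _ _ hP.ne']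
            congr 1
            ring
          rw [this]
          ring
    rw [s1, s2, s3, hq]
    ring
  · rw [Finset.disjoint_left]
    intro y; simp only [Finset.mem_Ico]; omega
  · rw [Finset.disjoint_left]
    intro y; simp only [Finset.mem_Ico, Finset.mem_union]; omega

/-! ### Convex combinations and half-space descriptions -/

/-- The missing weight is given to the base point `v`, as in barycentric coordinates of a simplex
with vertex `v`. -/
theorem Convex.add_sum_smul_mem {E ι : Type*} [AddCommGroup E] [Module ℝ E] {C : Set E}
    (hC : Convex ℝ C) {v : E} (hv : v ∈ C) (s : Finset ι) {w : ι → ℝ} {x : ι → E}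
    (hw : ∀ i ∈ s, 0 ≤ w i) (hw1 : ∑ i ∈ s, w i ≤ 1) (hx : ∀ i ∈ s, x i ∈ C) :
    (1 - ∑ i ∈ s, w i) • v + ∑ i ∈ s, w i • x i ∈ C := by
  have := hC.sum_mem (t := Finset.insertNone s) (w := fun o => o.elim (1 - ∑ i ∈ s, w i) w)
    (z := fun o => o.elim v x) ?_ ?_ ?_
  · simpa [Finset.sum_insertNone] using this
  · intro o ho
    cases o with
    | none => simpa using hw1
    | some i => exact hw i (by simpa using ho)
  · simp [Finset.sum_insertNone]
  · intro o ho
    cases o with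
    | none => exact hv
    | some i => exact hx i (by simpa using ho)

/-- The point `(x, y, z)` of `ℝ^(m+2)`. -/
def pt {m : ℕ} (x y : ℝ) (z : Fin m → ℝ) : Fin (m + 2) → ℝ :=
  Fin.cons x (Fin.cons y z : Fin (m + 1) → ℝ)

section pt
variable {m : ℕ} (x y : ℝ) (z : Fin m → ℝ)

@[simp] theorem pt_zero : pt x y z 0 = x := rfl

@[simp] theorem pt_one : pt x y z 1 = y := rfl

@[simp] theorem pt_succ_succ (i : Fin m) : pt x y z i.succ.succ = z i := rfl

theorem pt_ext {v w : Fin (m + 2) → ℝ} (h0 : v 0 = w 0) (h1 : v 1 = w 1)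
    (h : ∀ i : Fin m, v i.succ.succ = w i.succ.succ) : v = w := by
  funext i
  refine Fin.cases h0 (fun i => ?_) i
  exact Fin.cases h1 h i

theorem eq_pt (v : Fin (m + 2) → ℝ) : v = pt (v 0) (v 1) fun i => v i.succ.succ :=
  pt_ext rfl rfl fun _ => rfl

theorem single_succ_succ_eq_pt (i : Fin m) :
    (Pi.single i.succ.succ 1 : Fin (m + 2) → ℝ) = pt 0 0 (Pi.single i 1) := by
  refine pt_ext ?_ ?_ fun j => ?_
  · simp [eq_comm]
  · exact Pi.single_eq_of_ne (fun h => Fin.succ_ne_zero i (Fin.succ_injective _ h).symm) _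
  · simp [Pi.single_apply]

end pt

/-- The half-space description of `S_n`. -/
def hrepS (p m : ℕ) : Set (Fin (m + 1) → ℝ) :=
  {s | s 0 ≤ 0 ∧ (∀ i : Fin m, 0 ≤ s i.succ) ∧ -(p : ℝ) * s 0 + ∑ i : Fin m, s i.succ ≤ 1}

/-- The half-space description of `H_n`. -/
def hrepH (p m : ℕ) : Set (Fin (m + 2) → ℝ) :=
  {v | (∀ i : Fin m, 0 ≤ v i.succ.succ) ∧ ∑ i : Fin m, v i.succ.succ ≤ 1 ∧ |v 0| ≤ qOf p ∧
    ∑ i : Fin m, v i.succ.succ ≤ p * (v 1 + qOf p) + 1 ∧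
    |v 0| + v 1 + qOf p * ∑ i : Fin m, v i.succ.succ ≤ qOf p ∧
    (p - 1) * |v 0| + p ^ 2 * v 1 + p * qOf p * ∑ i : Fin m, v i.succ.succ ≤ p * qOf p}

theorem convex_hrepS (p m : ℕ) : Convex ℝ (hrepS p m) := by
  rintro x ⟨hx0, hx, hx1⟩ y ⟨hy0, hy, hy1⟩ a b ha hb hab
  refine ⟨?_, fun i => ?_, ?_⟩
  · simp only [Pi.add_apply, Pi.smul_apply, smul_eq_mul]
    nlinarith
  · simp only [Pi.add_apply, Pi.smul_apply, smul_eq_mul]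
    have := hx i; have := hy i; positivity
  · simp only [Pi.add_apply, Pi.smul_apply, smul_eq_mul, Finset.sum_add_distrib, ← Finset.mul_sum]
    have h1 := mul_le_mul_of_nonneg_left hx1 ha
    have h2 := mul_le_mul_of_nonneg_left hy1 hb
    linarith

theorem convex_hrepH {p : ℕ} (hp : 1 ≤ p) (m : ℕ) : Convex ℝ (hrepH p m) := by
  have hp1 : (1 : ℝ) ≤ p := by exact_mod_cast hp
  rintro x ⟨hx0, hx1, hx2, hx3, hx4, hx5⟩ y ⟨hy0, hy1, hy2, hy3, hy4, hy5⟩ a b ha hb hab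
  have habs : |a * x 0 + b * y 0| ≤ a * |x 0| + b * |y 0| := by
    refine (abs_add_le _ _).trans_eq ?_
    rw [abs_mul, abs_mul, abs_of_nonneg ha, abs_of_nonneg hb]
  have hc : ∀ {s t r : ℝ}, s ≤ r → t ≤ r → a * s + b * t ≤ r := fun {s t r} h1 h2 => by
    have h1 := mul_le_mul_of_nonneg_left h1 ha
    have h2 := mul_le_mul_of_nonneg_left h2 hb
    have : a * r + b * r = r := by rw [← add_mul, hab, one_mul]
    linarith
  simp only [hrepH, Set.mem_ofPred_eq, Pi.add_apply, Pi.smul_apply, smul_eq_mul,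
    Finset.sum_add_distrib, ← Finset.mul_sum]
  generalize (∑ i : Fin m, x i.succ.succ) = u at *
  generalize (∑ i : Fin m, y i.succ.succ) = u' at *
  generalize (qOf p : ℝ) = q at *
  refine ⟨fun i => ?_, hc hx1 hy1, habs.trans (hc hx2 hy2), ?_, ?_, ?_⟩
  · have := hx0 i; have := hy0 i; positivity
  · have := hc (sub_le_iff_le_add'.mpr hx3) (sub_le_iff_le_add'.mpr hy3)
    have h1 : a * (p * q) + b * (p * q) = p * q := by rw [← add_mul, hab, one_mul]
    linarith
  · have := hc hx4 hy4
    linarith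
  · have := hc hx5 hy5
    have := mul_le_mul_of_nonneg_left habs (show 0 ≤ (p : ℝ) - 1 by linarith)
    linarith

theorem simplexS_eq_hrepS {p : ℕ} (hp : 1 ≤ p) (m : ℕ) : simplexS p m = hrepS p m := by
  have hp1 : (1 : ℝ) ≤ p := by exact_mod_cast hp
  have hp0 : (p : ℝ) ≠ 0 := by positivity
  refine subset_antisymm (convexHull_min ?_ (convex_hrepS p m)) fun s ⟨h0, h1, h2⟩ => ?_
  · rintro s ((rfl | rfl) | ⟨k, hk, rfl⟩)
    · simp [hrepS]
    · refine ⟨?_, fun i => ?_, ?_⟩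
      · simp
      · simp
      · simp [hp0]
    · obtain ⟨i, rfl⟩ := Fin.exists_succ_eq.mpr hk
      refine ⟨?_, fun j => ?_, ?_⟩
      · simp [eq_comm]
      · simp only [Pi.single_apply]; positivity
      · simp [Pi.single_apply, eq_comm]
  · set C := convexHull ℝ ({0, Pi.single 0 (-(1 / (p : ℝ)))} ∪
      (fun k : Fin (m + 1) => (Pi.single k 1 : Fin (m + 1) → ℝ)) '' {k | k ≠ 0})
    have hA : _ ⊆ C := subset_convexHull ℝ _
    change s ∈ C
    have := (convex_convexHull ℝ _ : Convex ℝ C).add_sum_smul_mem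
      (hA (Or.inl (Or.inl rfl))) Finset.univ
      (w := Fin.cons (-(p : ℝ) * s 0) (Fin.tail s))
      (x := Fin.cons (Pi.single 0 (-(1 / (p : ℝ)))) fun i => Pi.single i.succ 1) ?_ ?_ ?_
    · convert this using 1
      rw [smul_zero, zero_add, Fin.sum_univ_succ]
      simp only [Fin.cons_zero, Fin.cons_succ]
      funext j
      refine Fin.cases ?_ (fun j => ?_) j
      · simp [Finset.sum_apply]
        field_simp
      · simp [Finset.sum_apply, Pi.single_apply, Fin.tail]
    · intro i _
      refine Fin.cases ?_ (fun i => ?_) i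
      · simp only [Fin.cons_zero]; nlinarith
      · exact h1 i
    · rw [Fin.sum_univ_succ]
      exact h2
    · intro i _
      refine Fin.cases ?_ (fun i => ?_) i
      · exact hA (Or.inl (Or.inr rfl))
      · exact hA (Or.inr ⟨i.succ, Fin.succ_ne_zero i, rfl⟩)

/-! ### `H_n` from its vertices and from its inequalities -/

/-- The vertices of `H_n` (together with the two points `(± q, -q, 0)`). -/
def verticesH (p m : ℕ) : Set (Fin (m + 2) → ℝ) :=
  {pt (qOf p) (-qOf p - 1 / p) 0, pt (-qOf p) (-qOf p - 1 / p) 0, pt (qOf p) (-qOf p) 0,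
    pt (-qOf p) (-qOf p) 0, pt (qOf p) 0 0, pt (-qOf p) 0 0, pt (qOf p - 1) 1 0,
    pt (-(qOf p - 1)) 1 0, pt 0 (qOf p / p) 0} ∪
  (Set.range (fun i => pt (qOf p) (-qOf p) (Pi.single i 1)) ∪
    (Set.range (fun i => pt (-qOf p) (-qOf p) (Pi.single i 1)) ∪
      Set.range (fun i => pt 0 0 (Pi.single i 1))))

theorem pt_add_sum_single {m : ℕ} (x y : ℝ) (z : Fin m → ℝ) (x' y' : ℝ) (w : ℝ) :
    w • pt x y (0 : Fin m → ℝ) + ∑ i, z i • pt x' y' (Pi.single i 1) =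
      pt (w * x + (∑ i, z i) * x') (w * y + (∑ i, z i) * y') z := by
  refine pt_ext ?_ ?_ fun j => ?_
  · simp [Finset.sum_apply, Finset.sum_mul]
  · simp [Finset.sum_apply, Finset.sum_mul]
  · simp [Finset.sum_apply, Pi.single_apply]

section
variable {m : ℕ} {C : Set (Fin (m + 2) → ℝ)}

theorem smul_pt_add_smul_pt (a b x y x' y' : ℝ) (z z' : Fin m → ℝ) :
    a • pt x y z + b • pt x' y' z' =
      pt (a * x + b * x') (a * y + b * y') (a • z + b • z') :=
  pt_ext rfl rfl fun _ => rfl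

theorem Convex.pt_mem_of_abs_le (hC : Convex ℝ C) {x y R : ℝ} {z : Fin m → ℝ}
    (h1 : pt R y z ∈ C) (h2 : pt (-R) y z ∈ C) (hx : |x| ≤ R) : pt x y z ∈ C := by
  obtain ⟨h3, h4⟩ := abs_le.mp hx
  rcases (show 0 ≤ R from (abs_nonneg x).trans hx).eq_or_lt with hR | hR
  · have : x = R := by linarith
    rwa [this]
  · have := hC h1 h2 (a := (R + x) / (2 * R)) (b := (R - x) / (2 * R))
      (div_nonneg (by linarith) (by linarith)) (div_nonneg (by linarith) (by linarith))
      (by field_simp; ring)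
    rw [smul_pt_add_smul_pt] at this
    convert this using 1
    refine pt_ext ?_ ?_ fun i => ?_
    · simp only [pt_zero]; field_simp; ring
    · simp only [pt_one]; field_simp; ring
    · simp only [pt_succ_succ, Pi.add_apply, Pi.smul_apply, smul_eq_mul]; field_simp; ring

/-- On each end `x = ±q`, the barycentric coordinates in the translated simplex are `-p(y + q)` and
the `z i`, the rest going to `(±q, -q, 0)`. The two ends are then joined by a segment. -/
theorem Convex.prism_subset {p : ℕ} (hp : 1 ≤ p) (hC : Convex ℝ C) (hA : verticesH p m ⊆ C)
    {x y : ℝ} {z : Fin m → ℝ} (hx : |x| ≤ qOf p) (hy : y + qOf p ≤ 0) (hz : ∀ i, 0 ≤ z i)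
    (hu : ∑ i, z i ≤ p * (y + qOf p) + 1) : pt x y z ∈ C := by
  have hp1 : (1 : ℝ) ≤ p := by exact_mod_cast hp
  have hp0 : (p : ℝ) ≠ 0 := by positivity
  have key : ∀ σ : ℝ, pt σ (-qOf p - 1 / p) 0 ∈ C → pt σ (-qOf p) 0 ∈ C →
      (∀ i, pt σ (-qOf p) (Pi.single i 1) ∈ C) → pt σ y z ∈ C := by
    intro σ h1 h2 h3
    have := hC.add_sum_smul_mem h2 Finset.univ
      (w := (Fin.cons (-(p : ℝ) * (y + qOf p)) z : Fin (m + 1) → ℝ))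
      (x := Fin.cons (pt σ (-qOf p - 1 / p) 0) fun i => pt σ (-qOf p) (Pi.single i 1)) ?_ ?_ ?_
    · convert this using 1
      simp only [Fin.sum_univ_succ, Fin.cons_zero, Fin.cons_succ]
      rw [← add_assoc, smul_pt_add_smul_pt, smul_zero, smul_zero, add_zero,
        ← one_smul ℝ (pt _ _ 0), pt_add_sum_single]
      refine pt_ext ?_ ?_ fun i => rfl
      · simp only [pt_zero]; ring
      · simp only [pt_one]; field_simp; ring
    · intro i _
      refine Fin.cases ?_ (fun i => ?_) i
      · simp only [Fin.cons_zero]; nlinarith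
      · exact hz i
    · simp only [Fin.sum_univ_succ, Fin.cons_zero, Fin.cons_succ]
      linarith
    · intro i _
      exact Fin.cases h1 h3 i
  refine hC.pt_mem_of_abs_le (key _ ?_ ?_ ?_) (key _ ?_ ?_ ?_) hx
  · exact hA (by simp [verticesH])
  · exact hA (by simp [verticesH])
  · exact fun i => hA (Or.inr (Or.inl ⟨i, rfl⟩))
  · exact hA (by simp [verticesH])
  · exact hA (by simp [verticesH])
  · exact fun i => hA (Or.inr (Or.inr (Or.inl ⟨i, rfl⟩)))

theorem Convex.pentagon_subset {p : ℕ} (hp : 1 ≤ p) (hC : Convex ℝ C) (hA : verticesH p m ⊆ C)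
    {x y : ℝ} (hy : 0 ≤ y) (h1 : |x| + y ≤ qOf p)
    (h2 : (p - 1) * |x| + p ^ 2 * y ≤ p * qOf p) : pt x y (0 : Fin m → ℝ) ∈ C := by
  have hp1 : (1 : ℝ) ≤ p := by exact_mod_cast hp
  have hp0 : (p : ℝ) ≠ 0 := by positivity
  have hq : (qOf p : ℝ) = (p : ℝ) ^ 2 - p + 1 := by simp [qOf]
  have m1 : pt (qOf p) 0 0 ∈ C := hA (by simp [verticesH])
  have m2 : pt (-qOf p) 0 0 ∈ C := hA (by simp [verticesH])
  have m3 : pt (qOf p - 1) 1 0 ∈ C := hA (by simp [verticesH])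
  have m4 : pt (-(qOf p - 1)) 1 0 ∈ C := hA (by simp [verticesH])
  have m5 : pt 0 (qOf p / p) 0 ∈ C := hA (by simp [verticesH])
  generalize (qOf p : ℝ) = q at *
  have hx := abs_nonneg x
  rcases le_total y 1 with hy1 | hy1
  · refine hC.pt_mem_of_abs_le (R := q - y) ?_ ?_ (by linarith)
    · have := hC m1 m3 (a := 1 - y) (b := y) (by linarith) hy (by ring)
      rw [smul_pt_add_smul_pt] at this
      convert this using 1
      refine pt_ext ?_ ?_ fun i => ?_ <;> simp
      ring
    · have := hC m2 m4 (a := 1 - y) (b := y) (by linarith) hy (by ring)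
      rw [smul_pt_add_smul_pt] at this
      convert this using 1
      refine pt_ext ?_ ?_ fun i => ?_ <;> simp
      ring
  · rcases hp1.eq_or_lt with hp2 | hp2
    · rw [← hp2] at hq h2
      have hx0 : x = 0 := abs_eq_zero.mp (by linarith)
      have hy0 : y = 1 := by linarith
      rw [show q - 1 = 0 by rw [hq]; norm_num] at m3
      rwa [hx0, hy0]
    · have hP : 0 < (p : ℝ) - 1 := by linarith
      have hb : y ≤ q / p := by
        rw [le_div_iff₀ (by linarith)]
        have : (p : ℝ) * (y * p) ≤ p * q := by nlinarith
        exact le_of_mul_le_mul_left this (by linarith)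
      -- The tip above `y = 1` has height `q/p - 1 = (p-1)²/p`, so this quotient is the relative
      -- height within the tip.
      have hs1 : p * (y - 1) / (p - 1) ^ 2 ≤ 1 := by
        rw [div_le_one (by positivity)]
        rw [le_div_iff₀ (by linarith)] at hb
        subst hq
        linarith
      have hs0 : 0 ≤ p * (y - 1) / (p - 1) ^ 2 :=
        div_nonneg (mul_nonneg (by linarith) (by linarith)) (by positivity)
      have hs : p * (y - 1) = p * (y - 1) / (p - 1) ^ 2 * (p - 1) ^ 2 := by field_simp
      generalize p * (y - 1) / (p - 1) ^ 2 = s at *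
      have hys : y = 1 - s + s * (q / p) := by
        field_simp
        subst hq
        linarith
      refine hC.pt_mem_of_abs_le (R := (1 - s) * (q - 1)) ?_ ?_ ?_
      · have := hC m3 m5 (a := 1 - s) (b := s) (by linarith) hs0 (by ring)
        rw [smul_pt_add_smul_pt] at this
        convert this using 1
        refine pt_ext ?_ ?_ fun i => ?_
        · simp
        · simpa using hys
        · simp
      · have := hC m4 m5 (a := 1 - s) (b := s) (by linarith) hs0 (by ring)
        rw [smul_pt_add_smul_pt] at this
        convert this using 1
        refine pt_ext ?_ ?_ fun i => ?_
        · simp; ring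
        · simpa using hys
        · simp
      · have h3 : p ^ 2 * y = p ^ 2 + p * (s * (p - 1) ^ 2) := by rw [← hs]; ring
        have h4 : (p - 1) * |x| ≤ (p - 1) * ((1 - s) * (q - 1)) := by
          subst hq
          linarith
        exact le_of_mul_le_mul_left h4 hP

/-- Projecting from the apexes divides `(x, y)` by `1 - ∑ z` and lands in the pentagon. If `∑ z =
1`, the inequalities force `x = y = 0` and any base point serves. -/
theorem Convex.pyramid_subset {p : ℕ} (hp : 1 ≤ p) (hC : Convex ℝ C) (hA : verticesH p m ⊆ C)
    {x y : ℝ} {z : Fin m → ℝ} (hy : 0 ≤ y) (hz : ∀ i, 0 ≤ z i)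
    (h1 : |x| + y + qOf p * ∑ i, z i ≤ qOf p)
    (h2 : (p - 1) * |x| + p ^ 2 * y + p * qOf p * ∑ i, z i ≤ p * qOf p) : pt x y z ∈ C := by
  have hp1 : (1 : ℝ) ≤ p := by exact_mod_cast hp
  have hq1 : (1 : ℝ) ≤ qOf p := by exact_mod_cast one_le_qOf hp
  have hx := abs_nonneg x
  set u := ∑ i, z i with hu
  have hu0 : 0 ≤ u := Finset.sum_nonneg fun i _ => hz i
  have hu1 : u ≤ 1 := by nlinarith
  obtain ⟨x', y', hx', hy', h⟩ : ∃ x' y', (1 - u) * x' = x ∧ (1 - u) * y' = y ∧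
      pt x' y' (0 : Fin m → ℝ) ∈ C := by
    rcases hu1.eq_or_lt with hu1 | hu1
    · rw [hu1] at h1
      have hx0 : x = 0 := abs_eq_zero.mp (by linarith)
      have hy0 : y = 0 := by linarith
      exact ⟨0, 0, by simp [hx0], by simp [hy0], hC.pentagon_subset hp hA le_rfl
        (by rw [abs_zero]; linarith)
        (by rw [abs_zero, mul_zero, mul_zero, add_zero]; positivity)⟩
    · have hu2 : 0 < 1 - u := by linarith
      refine ⟨x / (1 - u), y / (1 - u), by field_simp, by field_simp,
        hC.pentagon_subset hp hA (by positivity) ?_ ?_⟩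
      · rw [abs_div, abs_of_pos hu2, ← add_div, div_le_iff₀ hu2]
        linarith
      · rw [abs_div, abs_of_pos hu2, ← mul_div_assoc, ← mul_div_assoc, ← add_div,
          div_le_iff₀ hu2]
        linarith
  have := hC.add_sum_smul_mem h Finset.univ (w := z) (fun i _ => hz i) hu1
    (fun i _ => hA (Or.inr (Or.inr (Or.inr ⟨i, rfl⟩))))
  rw [pt_add_sum_single, ← hu] at this
  simpa [hx', hy'] using this

/-- This splits `ξ` into `min ξ t` and the excess over `t`, as multiples of `ξ`, so that a signed
coordinate or a whole vector of size `ξ` can be split in the same proportion. -/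
theorem exists_truncation {ξ t : ℝ} (ht : 0 < t) :
    ∃ α : ℝ, 0 ≤ α ∧ α ≤ 1 ∧ ξ * α ≤ t ∧ ξ * (1 - α) = max 0 (ξ - t) := by
  rcases le_or_gt ξ t with h | h
  · exact ⟨1, zero_le_one, le_rfl, by linarith, by rw [max_eq_left (by linarith)]; ring⟩
  · have hξ' : 0 < ξ := ht.trans h
    refine ⟨t / ξ, by positivity, (div_le_one hξ').mpr h.le, ?_, ?_⟩
    · rw [mul_div_cancel₀ _ hξ'.ne']
    · rw [max_eq_right (by linarith)]
      field_simp

/-- For `-q < y < 0`, put `t = -y/q` and seek the point as `t` times a prism point at height `-q`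
plus `1 - t` times a pyramid point at height `0`. With `ξ = |x|/q` and `u = ∑ z`, the prism part may
carry at most `t` of `ξ` and `t` of `u` separately; the pyramid part must carry at most `1 - t` in
total. Giving the prism as much as possible works because `ξ ≤ 1`, `u ≤ 1` and `ξ + u ≤ 1 + t`. -/
theorem Convex.hrepH_subset {p : ℕ} (hp : 1 ≤ p) (hC : Convex ℝ C) (hA : verticesH p m ⊆ C) :
    hrepH p m ⊆ C := by
  rintro v ⟨h0, h1, h2, h3, h4, h5⟩
  have hq1 : (1 : ℝ) ≤ qOf p := by exact_mod_cast one_le_qOf hp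
  have hq0 : (0 : ℝ) < qOf p := by linarith
  have hq0' : (qOf p : ℝ) ≠ 0 := hq0.ne'
  rw [eq_pt v]
  rcases le_or_gt 0 (v 1) with hy | hy
  · exact hC.pyramid_subset hp hA hy h0 h4 h5
  rcases le_or_gt (v 1 + qOf p) 0 with hy' | hy'
  · exact hC.prism_subset hp hA h2 hy' h0 h3
  obtain ⟨t, ht⟩ : ∃ t, t = -v 1 / qOf p := ⟨_, rfl⟩
  have hyt : v 1 = -(t * qOf p) := by rw [ht]; field_simp
  have ht0 : 0 < t := by rw [ht]; exact div_pos (by linarith) hq0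
  have ht1 : t < 1 := by rw [ht, div_lt_one hq0]; linarith
  have hs : 0 < 1 - t := by linarith
  set u := ∑ i : Fin m, v i.succ.succ with hu
  have hu0 : 0 ≤ u := Finset.sum_nonneg fun i _ => h0 i
  obtain ⟨ξ, hξ⟩ : ∃ ξ, ξ = |v 0| / qOf p := ⟨_, rfl⟩
  have hxξ : |v 0| = qOf p * ξ := by rw [hξ]; field_simp
  have hξ0 : 0 ≤ ξ := by rw [hξ]; positivity
  have hξ1 : ξ ≤ 1 := by rw [hξ, div_le_one hq0]; exact h2
  have hsum : ξ + u ≤ 1 + t := by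
    have : qOf p * (ξ + u) ≤ qOf p * (1 + t) := by rw [hyt, hxξ] at h4; linarith
    exact le_of_mul_le_mul_left this hq0
  obtain ⟨α, hα0, hα1, hα, hα'⟩ := exists_truncation (ξ := ξ) ht0
  obtain ⟨β, hβ0, hβ1, hβ, hβ'⟩ := exists_truncation (ξ := u) ht0
  have hrest : ξ * (1 - α) + u * (1 - β) ≤ 1 - t := by
    rw [hα', hβ']
    rcases max_cases 0 (ξ - t) with ⟨h, -⟩ | ⟨h, -⟩ <;>
      rcases max_cases 0 (u - t) with ⟨h', -⟩ | ⟨h', -⟩ <;> rw [h, h'] <;> linarith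
  have m1 : pt (v 0 * α / t) (-qOf p) (fun i => v (Fin.succ (Fin.succ i)) * β / t) ∈ C := by
    refine hC.prism_subset hp hA ?_ (by linarith) (fun i => ?_) ?_
    · rw [abs_div, abs_mul, abs_of_nonneg hα0, abs_of_pos ht0, hxξ, div_le_iff₀ ht0, mul_assoc]
      exact mul_le_mul_of_nonneg_left hα hq0.le
    · have := h0 i; positivity
    · rw [← Finset.sum_div, ← Finset.sum_mul, ← hu, div_le_iff₀ ht0]
      linarith
  have hnorm : |v 0 * (1 - α) / (1 - t)| = qOf p * (ξ * (1 - α)) / (1 - t) := by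
    rw [abs_div, abs_mul, abs_of_nonneg (show 0 ≤ 1 - α by linarith), abs_of_pos hs, hxξ, mul_assoc]
  have hsum' : ∑ i : Fin m, v i.succ.succ * (1 - β) / (1 - t) = u * (1 - β) / (1 - t) := by
    rw [← Finset.sum_div, ← Finset.sum_mul]
  have hfin : qOf p * (ξ * (1 - α)) / (1 - t) + 0 + qOf p * (u * (1 - β) / (1 - t)) ≤ qOf p := by
    rw [add_zero, ← mul_div_assoc, ← add_div, div_le_iff₀ hs, ← mul_add]
    exact mul_le_mul_of_nonneg_left hrest hq0.le
  have m2 : pt (v 0 * (1 - α) / (1 - t)) 0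
      (fun i => v (Fin.succ (Fin.succ i)) * (1 - β) / (1 - t)) ∈ C := by
    refine hC.pyramid_subset hp hA le_rfl (fun i => ?_) ?_ ?_
    · have := h0 i
      exact div_nonneg (mul_nonneg this (by linarith)) hs.le
    · rwa [hnorm, hsum']
    · rw [hnorm, hsum']
      have h6 := mul_le_mul_of_nonneg_left hfin (show (0 : ℝ) ≤ p by positivity)
      have h7 : 0 ≤ qOf p * (ξ * (1 - α)) / (1 - t) :=
        div_nonneg (mul_nonneg hq0.le (mul_nonneg hξ0 (by linarith))) hs.le
      linarith
  have := hC m1 m2 (a := t) (b := 1 - t) ht0.le hs.le (by ring)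
  rw [smul_pt_add_smul_pt] at this
  convert this using 1
  refine pt_ext ?_ ?_ fun i => ?_
  · simp only [pt_zero]; field_simp; ring
  · simp only [pt_one]; rw [hyt]; ring
  · simp only [pt_succ_succ, Pi.add_apply, Pi.smul_apply, smul_eq_mul]; field_simp; ring

end

theorem pt_mem_pentagonEmbedded {p m : ℕ} {x y : ℝ} (h : ![x, y] ∈ pentagon p) :
    pt x y (0 : Fin m → ℝ) ∈ pentagonEmbedded p m :=
  ⟨_, h, pt_ext rfl rfl fun i => by simp⟩

theorem pt_mem_prismW {p m : ℕ} {x y : ℝ} {z : Fin m → ℝ}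
    (hx : x ∈ Set.Icc (-(qOf p : ℝ)) (qOf p : ℝ))
    (hs : (Fin.cons y z : Fin (m + 1) → ℝ) ∈ simplexS p m) :
    pt x (-qOf p + y) z ∈ prismW p m := by
  refine ⟨pt x y z, ⟨hx, hs⟩, pt_ext ?_ ?_ fun i => ?_⟩
  · simp
  · simp; ring
  · have : (i.succ.succ : Fin (m + 2)) ≠ 1 := fun h =>
      Fin.succ_ne_zero i (Fin.succ_injective _ h)
    simp [Pi.single_eq_of_ne this]

theorem verticesH_subset {p : ℕ} (hp : 1 ≤ p) (m : ℕ) :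
    verticesH p m ⊆ prismW p m ∪ pyramidP p m := by
  have hp1 : (1 : ℝ) ≤ p := by exact_mod_cast hp
  have hp0 : (p : ℝ) ≠ 0 := by positivity
  have hq1 : (1 : ℝ) ≤ qOf p := by exact_mod_cast one_le_qOf hp
  have hpent : ∀ {x y : ℝ}, ![x, y] ∈ pentagon p → pt x y (0 : Fin m → ℝ) ∈ pyramidP p m :=
    fun h => subset_convexHull ℝ _ (Or.inl (pt_mem_pentagonEmbedded h))
  have hI : (qOf p : ℝ) ∈ Set.Icc (-(qOf p : ℝ)) (qOf p : ℝ) := ⟨by linarith, le_rfl⟩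
  have hI' : -(qOf p : ℝ) ∈ Set.Icc (-(qOf p : ℝ)) (qOf p : ℝ) := ⟨le_rfl, by linarith⟩
  have s0 : (Fin.cons 0 0 : Fin (m + 1) → ℝ) ∈ simplexS p m := by
    rw [simplexS_eq_hrepS hp]; simp [hrepS]
  have s1 : (Fin.cons (-(1 / (p : ℝ))) 0 : Fin (m + 1) → ℝ) ∈ simplexS p m := by
    rw [simplexS_eq_hrepS hp]; simp [hrepS, hp0]
  have s2 : ∀ i, (Fin.cons 0 (Pi.single i 1) : Fin (m + 1) → ℝ) ∈ simplexS p m := fun i => by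
    rw [simplexS_eq_hrepS hp]
    refine ⟨by simp, fun j => ?_, by simp⟩
    simp only [Fin.cons_succ, Pi.single_apply]
    positivity
  rintro v ((rfl | rfl | rfl | rfl | rfl | rfl | rfl | rfl | rfl) | ⟨i, rfl⟩ | ⟨i, rfl⟩ | ⟨i, rfl⟩)
  · exact Or.inl (pt_mem_prismW hI s1)
  · exact Or.inl (pt_mem_prismW hI' s1)
  · have := pt_mem_prismW hI s0
    rw [add_zero] at this
    exact Or.inl this
  · have := pt_mem_prismW hI' s0
    rw [add_zero] at this
    exact Or.inl this
  · exact Or.inr (hpent (subset_convexHull ℝ _ (by simp)))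
  · exact Or.inr (hpent (subset_convexHull ℝ _ (by simp)))
  · exact Or.inr (hpent (subset_convexHull ℝ _ (by simp)))
  · exact Or.inr (hpent (subset_convexHull ℝ _ (by simp)))
  · exact Or.inr (hpent (subset_convexHull ℝ _ (by simp)))
  · have := pt_mem_prismW hI (s2 i)
    rw [add_zero] at this
    exact Or.inl this
  · have := pt_mem_prismW hI' (s2 i)
    rw [add_zero] at this
    exact Or.inl this
  · refine Or.inr (subset_convexHull ℝ _ (Or.inr ⟨i.succ.succ, ?_, single_succ_succ_eq_pt i⟩))
    simp

theorem prismW_subset_hrepH {p : ℕ} (hp : 1 ≤ p) (m : ℕ) : prismW p m ⊆ hrepH p m := by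
  have hp1 : (1 : ℝ) ≤ p := by exact_mod_cast hp
  have hq1 : (1 : ℝ) ≤ qOf p := by exact_mod_cast one_le_qOf hp
  have hq : (qOf p : ℝ) = (p : ℝ) ^ 2 - p + 1 := by simp [qOf]
  rintro _ ⟨v, ⟨hv, hs⟩, rfl⟩
  rw [simplexS_eq_hrepS hp] at hs
  obtain ⟨h0, h1, h2⟩ := hs
  have hne : ∀ i : Fin m, (i.succ.succ : Fin (m + 2)) ≠ 1 := fun i h =>
    Fin.succ_ne_zero i (Fin.succ_injective _ h)
  have hu0 : 0 ≤ ∑ i : Fin m, v i.succ.succ := Finset.sum_nonneg fun i _ => h1 i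
  have hx : |v 0| ≤ qOf p := abs_le.mpr hv
  simp only [Fin.tail, Fin.succ_zero_eq_one] at h0 h1 h2
  simp only [hrepH, Set.mem_ofPred_eq, Pi.sub_apply, Pi.single_eq_same,
    Pi.single_eq_of_ne (hne _), Pi.single_eq_of_ne (zero_ne_one : (0 : Fin (m + 2)) ≠ 1), sub_zero]
  have hX := abs_nonneg (v 0)
  generalize (∑ i : Fin m, v i.succ.succ) = u at *
  have hu1 : u ≤ 1 := by nlinarith
  have hqu : qOf p * u ≤ qOf p := by nlinarith
  refine ⟨h1, hu1, hx, by linarith, by linarith, ?_⟩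
  have h3 := mul_le_mul_of_nonneg_left hx (show 0 ≤ (p : ℝ) - 1 by linarith)
  have h4 := mul_le_mul_of_nonneg_left h0 (show 0 ≤ (p : ℝ) ^ 2 by positivity)
  have h5 := mul_le_mul_of_nonneg_left hqu (show 0 ≤ (p : ℝ) by positivity)
  have h6 : ((p : ℝ) - 1 - p ^ 2) * qOf p ≤ 0 :=
    mul_nonpos_of_nonpos_of_nonneg (by nlinarith) (by linarith)
  linarith

theorem pentagonEmbedded_subset_hrepH {p : ℕ} (hp : 1 ≤ p) (m : ℕ) :
    pentagonEmbedded p m ⊆ hrepH p m := by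
  have hp1 : (1 : ℝ) ≤ p := by exact_mod_cast hp
  have hp0 : (p : ℝ) ≠ 0 := by positivity
  have hq1 : (1 : ℝ) ≤ qOf p := by exact_mod_cast one_le_qOf hp
  have hq : (qOf p : ℝ) = (p : ℝ) ^ 2 - p + 1 := by simp [qOf]
  have hlin : IsLinearMap ℝ (fun (v : Fin 2 → ℝ) (j : Fin (m + 2)) =>
      if h : (j : ℕ) < 2 then v ⟨(j : ℕ), h⟩ else 0) := by
    constructor
    · intro v w; funext j
      by_cases h : (j : ℕ) < 2 <;> simp only [h, dite_true, dite_false, Pi.add_apply, add_zero]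
    · intro a v; funext j
      by_cases h : (j : ℕ) < 2 <;> simp only [h, dite_true, dite_false, Pi.smul_apply, smul_zero]
  have hq0 : (0 : ℝ) ≤ qOf p := by linarith
  have hq2 : (0 : ℝ) ≤ qOf p - 1 := by linarith
  have hpq : (p : ℝ) ≤ qOf p := by nlinarith [sq_nonneg ((p : ℝ) - 1)]
  refine Set.image_subset_iff.mpr (convexHull_min ?_ ((convex_hrepH hp m).is_linear_preimage hlin))
  have key : ∀ v : Fin 2 → ℝ, 0 ≤ v 1 → |v 0| + v 1 ≤ qOf p →
      (p - 1) * |v 0| + p ^ 2 * v 1 ≤ p * qOf p →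
      v ∈ (fun (v : Fin 2 → ℝ) (j : Fin (m + 2)) =>
        if h : (j : ℕ) < 2 then v ⟨(j : ℕ), h⟩ else 0) ⁻¹' hrepH p m := by
    intro v h0 h1 h2
    have hX := abs_nonneg (v 0)
    have h3 : 0 ≤ (p : ℝ) * (v 1 + qOf p) + 1 := by positivity
    simpa [hrepH] using ⟨by linarith, h3, h1, h2⟩
  rintro v (rfl | rfl | rfl | rfl | rfl) <;> apply key <;>
    simp only [Matrix.cons_val_zero, Matrix.cons_val_one, abs_neg, abs_of_nonneg hq0,
      abs_of_nonneg hq2, abs_zero]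
  · exact le_rfl
  · linarith
  · linarith
  · exact le_rfl
  · linarith
  · linarith
  · exact zero_le_one
  · linarith
  · rw [hq]; linarith
  · exact zero_le_one
  · linarith
  · rw [hq]; linarith
  · positivity
  · rw [zero_add, div_le_iff₀ (by linarith)]
    nlinarith
  · rw [mul_zero, zero_add]
    apply le_of_eq
    field_simp

theorem polytopeH_eq {p : ℕ} (hp : 1 ≤ p) (m : ℕ) :
    polytopeH p m = hrepH p m ∧ polytopeH p m = convexHull ℝ (verticesH p m) := by
  have hq1 : (1 : ℝ) ≤ qOf p := by exact_mod_cast one_le_qOf hp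
  have hqZ : 0 ≤ qOf p := zero_le_one.trans (one_le_qOf hp)
  have h1 : polytopeH p m ⊆ hrepH p m := by
    refine convexHull_min (Set.union_subset (prismW_subset_hrepH hp m) ?_) (convex_hrepH hp m)
    refine convexHull_min (Set.union_subset (pentagonEmbedded_subset_hrepH hp m) ?_)
      (convex_hrepH hp m)
    rintro _ ⟨k, hk, rfl⟩
    obtain ⟨i, rfl⟩ : ∃ i : Fin m, k = i.succ.succ :=
      ⟨⟨k - 2, by have := k.2; simp at hk; omega⟩, by ext; simp at hk ⊢; omega⟩
    simp only [single_succ_succ_eq_pt]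
    refine ⟨fun j => ?_, ?_⟩
    · simp only [pt_succ_succ, Pi.single_apply]
      positivity
    · simp
      exact ⟨hqZ, by positivity⟩
  have h2 : hrepH p m ⊆ convexHull ℝ (verticesH p m) :=
    (convex_convexHull ℝ _).hrepH_subset hp (subset_convexHull ℝ _)
  have h3 : convexHull ℝ (verticesH p m) ⊆ polytopeH p m :=
    convexHull_mono (verticesH_subset hp m)
  exact ⟨h1.antisymm (h2.trans h3), (h1.trans h2).antisymm h3⟩

/-! ### Rationality and dimension -/

theorem isConvexRationalPolytope_convexHull {d : ℕ} {A : Set (Fin d → ℝ)} (hA : A.Finite)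
    (hrat : ∀ v ∈ A, ∀ j, v j ∈ Set.range ((↑) : ℚ → ℝ)) :
    IsConvexRationalPolytope (convexHull ℝ A) := by
  let φ : (Fin d → ℚ) → Fin d → ℝ := fun v j => (v j : ℝ)
  have hφ : Function.Injective φ := fun v w h => funext fun j => by
    exact Rat.cast_injective (congrFun h j)
  have hfin : (φ ⁻¹' A).Finite := hA.preimage hφ.injOn
  refine ⟨hfin.toFinset, ?_⟩
  rw [hfin.coe_toFinset]
  congr 1
  refine (Set.image_preimage_eq_of_subset fun v hv => ?_).symm
  choose w hw using hrat v hv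
  exact ⟨w, funext hw⟩

theorem isConvexRationalPolytope_polytopeH {p : ℕ} (hp : 1 ≤ p) (m : ℕ) :
    IsConvexRationalPolytope (polytopeH p m) := by
  rw [(polytopeH_eq hp m).2]
  refine isConvexRationalPolytope_convexHull ?_ ?_
  · refine Set.Finite.union (by simp) ?_
    exact (Set.finite_range _).union ((Set.finite_range _).union (Set.finite_range _))
  · have key : ∀ (x y : ℚ) (z : Fin m → ℚ) (j : Fin (m + 2)),
        pt (x : ℝ) (y : ℝ) (fun i => (z i : ℝ)) j ∈ Set.range ((↑) : ℚ → ℝ) := by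
      intro x y z j
      refine Fin.cases ⟨x, rfl⟩ (fun j => ?_) j
      exact Fin.cases ⟨y, rfl⟩ (fun j => ⟨z j, rfl⟩) j
    have key0 : ∀ (x y : ℚ) (j : Fin (m + 2)),
        pt (x : ℝ) (y : ℝ) (0 : Fin m → ℝ) j ∈ Set.range ((↑) : ℚ → ℝ) := by
      intro x y j
      convert key x y 0 j
      simp
    have key1 : ∀ (x y : ℚ) (i : Fin m) (j : Fin (m + 2)),
        pt (x : ℝ) (y : ℝ) (Pi.single i 1 : Fin m → ℝ) j ∈ Set.range ((↑) : ℚ → ℝ) := by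
      intro x y i j
      convert key x y (Pi.single i 1) j with l
      simp only [Pi.single_apply]
      split_ifs <;> simp
    rintro v ((rfl | rfl | rfl | rfl | rfl | rfl | rfl | rfl | rfl) |
      ⟨i, rfl⟩ | ⟨i, rfl⟩ | ⟨i, rfl⟩) j
    · simpa using key0 (qOf p) (-qOf p - 1 / p) j
    · simpa using key0 (-qOf p) (-qOf p - 1 / p) j
    · simpa using key0 (qOf p) (-qOf p) j
    · simpa using key0 (-qOf p) (-qOf p) j
    · simpa using key0 (qOf p) 0 j
    · simpa using key0 (-qOf p) 0 j
    · simpa using key0 (qOf p - 1) 1 j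
    · simpa using key0 (-(qOf p - 1)) 1 j
    · simpa using key0 0 (qOf p / p) j
    · simpa using key1 (qOf p) (-qOf p) i j
    · simpa using key1 (-qOf p) (-qOf p) i j
    · simpa using key1 0 0 i j

/-- The origin and all standard basis vectors satisfy the inequalities of `H_n`. -/
theorem affineDim_polytopeH {p : ℕ} (hp : 1 ≤ p) (m : ℕ) :
    affineDim (polytopeH p m) = m + 2 := by
  have hp1 : (1 : ℝ) ≤ p := by exact_mod_cast hp
  have hq1 : (1 : ℝ) ≤ qOf p := by exact_mod_cast one_le_qOf hp
  have hqZ : 0 ≤ qOf p := zero_le_one.trans (one_le_qOf hp)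
  have hq : (qOf p : ℝ) = (p : ℝ) ^ 2 - p + 1 := by simp [qOf]
  have hpq : (p : ℝ) ≤ qOf p := by nlinarith [sq_nonneg ((p : ℝ) - 1)]
  have hpq0 : 0 ≤ (p : ℝ) * qOf p := by positivity
  have hmem : ∀ {x y : ℝ} {z : Fin m → ℝ}, pt x y z ∈ hrepH p m →
      pt x y z ∈ vectorSpan ℝ (polytopeH p m) := by
    intro x y z h
    rw [(polytopeH_eq hp m).1]
    have h0 : (0 : Fin (m + 2) → ℝ) ∈ hrepH p m := by
      simp [hrepH]
      exact ⟨hqZ, by positivity, hqZ, hpq0⟩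
    simpa using vsub_mem_vectorSpan ℝ h h0
  have htop : vectorSpan ℝ (polytopeH p m) = ⊤ := by
    rw [eq_top_iff]
    rintro v -
    have e0 : pt 1 0 (0 : Fin m → ℝ) ∈ vectorSpan ℝ (polytopeH p m) := hmem (by
      simp [hrepH]
      exact ⟨hq1, by positivity, hq1, by nlinarith⟩)
    have e1 : pt 0 1 (0 : Fin m → ℝ) ∈ vectorSpan ℝ (polytopeH p m) := hmem (by
      simp [hrepH]
      exact ⟨hqZ, by positivity, hq1, by nlinarith⟩)
    have e2 : ∀ i, pt 0 0 (Pi.single i 1 : Fin m → ℝ) ∈ vectorSpan ℝ (polytopeH p m) := fun i =>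
      hmem ⟨fun j => by simp only [pt_succ_succ, Pi.single_apply]; positivity, by
        simp
        exact ⟨hqZ, by positivity⟩⟩
    have : v = v 0 • pt 1 0 (0 : Fin m → ℝ) + (v 1 • pt 0 1 (0 : Fin m → ℝ) +
        ∑ i : Fin m, v i.succ.succ • pt 0 0 (Pi.single i 1 : Fin m → ℝ)) := by
      rw [pt_add_sum_single _ _ (fun i : Fin m => v i.succ.succ)]
      refine pt_ext ?_ ?_ fun i => ?_ <;> simp
    rw [this]
    exact add_mem (Submodule.smul_mem _ _ e0) (add_mem (Submodule.smul_mem _ _ e1)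
      (Submodule.sum_mem _ fun i _ => Submodule.smul_mem _ _ (e2 i)))
  rw [affineDim, htop, finrank_top, Module.finrank_fin_fun]

/-! ### Iterated pyramids -/

theorem coneOver_convexHull {d : ℕ} (A : Set (Fin d → ℝ)) (a : Fin (d + 1) → ℝ) :
    coneOver (convexHull ℝ A) a =
      convexHull ℝ ((fun x : Fin d → ℝ => (Fin.snoc x 0 : Fin (d + 1) → ℝ)) '' A ∪ {a}) := by
  have hlin : IsLinearMap ℝ (fun x : Fin d → ℝ => (Fin.snoc x 0 : Fin (d + 1) → ℝ)) := by
    constructor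
    · intro x y
      funext j
      refine Fin.lastCases ?_ (fun j => ?_) j <;> simp
    · intro c x
      funext j
      refine Fin.lastCases ?_ (fun j => ?_) j <;> simp
  rw [coneOver, hlin.image_convexHull, convexHull_convexHull_union_left]

theorem snoc_single_zero {d : ℕ} (k : Fin d) (a : ℝ) :
    (Fin.snoc (Pi.single k a : Fin d → ℝ) 0 : Fin (d + 1) → ℝ) = Pi.single k.castSucc a := by
  funext j
  refine Fin.lastCases ?_ (fun j => ?_) j
  · simp
  · simp [Pi.single_apply]

theorem snoc_zero_zero {d : ℕ} : (Fin.snoc (0 : Fin d → ℝ) 0 : Fin (d + 1) → ℝ) = 0 := by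
  funext j
  refine Fin.lastCases ?_ (fun j => ?_) j <;> simp

theorem isFoldPyramid_succ {d e i : ℕ} {Q : Set (Fin d → ℝ)} {A : Set (Fin e → ℝ)}
    {B : Set (Fin (e + 1) → ℝ)} (h : IsFoldPyramid Q i (convexHull ℝ A))
    (hB : B = (fun x : Fin e → ℝ => (Fin.snoc x 0 : Fin (e + 1) → ℝ)) '' A ∪
      {Pi.single (Fin.last e) 1}) : IsFoldPyramid Q (i + 1) (convexHull ℝ B) := by
  have := IsFoldPyramid.step (Pi.single (Fin.last e) 1) (by simp) h
  rw [coneOver_convexHull] at this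
  rw [hB]
  convert this using 4
  funext j
  simp only [Pi.single_apply]
  split_ifs <;> simp

/-- The unit vectors with index in `s`, after appending a coordinate. -/
theorem image_snoc_single_union {d : ℕ} (s : Set (Fin d)) :
    (fun x : Fin d → ℝ => (Fin.snoc x 0 : Fin (d + 1) → ℝ)) ''
        ((fun k => (Pi.single k 1 : Fin d → ℝ)) '' s) ∪ {Pi.single (Fin.last d) 1} =
      (fun k => (Pi.single k 1 : Fin (d + 1) → ℝ)) '' (Fin.castSucc '' s ∪ {Fin.last d}) := by
  rw [Set.image_union, Set.image_singleton, Set.image_image, Set.image_image]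
  simp only [snoc_single_zero]

theorem isFoldPyramid_simplexS {p : ℕ} (hp : 1 ≤ p) (m : ℕ) :
    IsFoldPyramid (segmentL p) m (simplexS p m) := by
  induction m with
  | zero =>
    have hp0 : (0 : ℝ) < p := by positivity
    have : segmentL p = simplexS p 0 := by
      rw [simplexS_eq_hrepS hp]
      ext s
      simp only [segmentL, hrepS, Set.mem_ofPred_eq, Set.mem_Icc, Finset.univ_eq_empty,
        Finset.sum_empty, add_zero, IsEmpty.forall_iff, true_and]
      rw [and_comm]
      refine and_congr_right fun _ => ?_
      rw [neg_le, le_div_iff₀ hp0, neg_mul, neg_mul, mul_comm]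
    rw [this]
    exact IsFoldPyramid.base
  | succ m ih =>
    refine isFoldPyramid_succ ih ?_
    rw [Set.image_union, Set.union_assoc, image_snoc_single_union, Set.image_pair,
      snoc_zero_zero, snoc_single_zero]
    congr 2
    ext k
    refine Fin.lastCases ?_ (fun k => ?_) k
    · simp
    · simp [Fin.castSucc_ne_last]

theorem isFoldPyramid_pyramidP (p m : ℕ) : IsFoldPyramid (pentagon p) m (pyramidP p m) := by
  induction m with
  | zero =>
    have : pentagon p = pyramidP p 0 := by
      have h1 : {k : Fin 2 | 2 ≤ (k : ℕ)} = ∅ := by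
        ext k
        simp only [Set.mem_ofPred_eq, Set.mem_empty_iff_false, iff_false, not_le]
        exact k.2
      have h2 : pentagonEmbedded p 0 = pentagon p := by
        refine (Set.image_congr fun v _ => ?_).trans (Set.image_id _)
        funext j
        exact dif_pos j.2
      rw [pyramidP, h1, Set.image_empty, Set.union_empty, h2]
      exact ((convex_convexHull ℝ _).convexHull_eq).symm
    rw [this]
    exact IsFoldPyramid.base
  | succ m ih =>
    refine isFoldPyramid_succ ih ?_
    rw [Set.image_union, Set.union_assoc, image_snoc_single_union]
    congr 1
    · rw [pentagonEmbedded, pentagonEmbedded, Set.image_image]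
      refine Set.image_congr fun v _ => ?_
      funext j
      refine Fin.lastCases ?_ (fun j => ?_) j <;> simp
    · congr 1
      ext k
      refine Fin.lastCases ?_ (fun k => ?_) k
      · simp
      · simp [Fin.castSucc_ne_last]

/-! ### Lattice counts of the dilates -/

theorem mem_natCast_smul_iff {E : Type*} [AddCommGroup E] [Module ℝ E] {K : Set E} {k : ℕ}
    (hk : 1 ≤ k) {v : E} : v ∈ (k : ℝ) • K ↔ (k : ℝ)⁻¹ • v ∈ K :=
  Set.mem_smul_set_iff_inv_smul_mem₀ (by positivity) _ _

theorem mem_smul_hrepS {p m k : ℕ} (hk : 1 ≤ k) (z : Fin (m + 1) → ℤ) :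
    (fun j => (z j : ℝ)) ∈ (k : ℝ) • hrepS p m ↔
      z 0 ≤ 0 ∧ (∀ i : Fin m, 0 ≤ z i.succ) ∧ -(p : ℤ) * z 0 + ∑ i : Fin m, z i.succ ≤ k := by
  have hk0 : (0 : ℝ) < k := by positivity
  have hk1 : (0 : ℝ) < (k : ℝ)⁻¹ := by positivity
  rw [mem_natCast_smul_iff hk]
  simp only [hrepS, Set.mem_ofPred_eq, Pi.smul_apply, smul_eq_mul, ← Finset.mul_sum,
    mul_nonneg_iff_of_pos_left hk1]
  refine and_congr (by rw [inv_mul_le_iff₀ hk0, mul_zero]; norm_cast) (and_congr (by norm_cast) ?_)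
  rw [mul_left_comm, ← mul_add, inv_mul_le_iff₀ hk0, mul_one]
  norm_cast

/-- After scaling by `k`, `∑ z` enters the planar inequalities only through `k - ∑ z`; this is why
all fibres over equal sums coincide. -/
theorem mem_smul_hrepH {p m k : ℕ} (hk : 1 ≤ k) (z : Fin (m + 2) → ℤ) :
    (fun j => (z j : ℝ)) ∈ (k : ℝ) • hrepH p m ↔
      (∀ i : Fin m, 0 ≤ z i.succ.succ) ∧ ∑ i : Fin m, z i.succ.succ ≤ k ∧
        (z 0, z 1) ∈ sliceH p k (k - ∑ i : Fin m, z i.succ.succ) := by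
  have hk0 : (0 : ℝ) < k := by positivity
  have hk1 : (0 : ℝ) < (k : ℝ)⁻¹ := by positivity
  have hc : ∀ {a b a' b' : ℝ}, a' * k = a → b' * k = b → (a' ≤ b' ↔ a ≤ b) := by
    rintro a b a' b' rfl rfl
    exact (mul_le_mul_iff_of_pos_right hk0).symm
  rw [mem_natCast_smul_iff hk]
  simp only [hrepH, sliceH, Set.mem_ofPred_eq, Pi.smul_apply, smul_eq_mul, ← Finset.mul_sum,
    mul_nonneg_iff_of_pos_left hk1, abs_mul, abs_of_pos hk1, ← Int.cast_le (R := ℝ)]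
  push_cast
  generalize (∑ i : Fin m, (z i.succ.succ : ℝ)) = u
  refine and_congr Iff.rfl (and_congr (hc ?_ ?_) (and_congr (hc ?_ rfl) (and_congr ?_
    (and_congr ?_ ?_))))
  · field_simp
  · ring
  · field_simp
  · rw [← sub_nonneg, ← sub_nonneg (a := _ * _)]
    refine hc (zero_mul _) ?_
    field_simp
    ring
  · rw [← sub_nonneg, ← sub_nonneg (b := _ + _)]
    refine hc (zero_mul _) ?_
    field_simp
    ring
  · rw [← sub_nonneg, ← sub_nonneg (b := _ + _)]
    refine hc (zero_mul _) ?_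
    field_simp
    ring

theorem latticeCount_simplexS {p : ℕ} (hp : 1 ≤ p) (m : ℕ) {k : ℕ} (hk : 1 ≤ k) :
    (latticeCount ((k : ℝ) • simplexS p m) : ℚ) =
      iterSum m (fun j => ((j / p : ℕ) : ℚ) + 1) k := by
  let B : ℕ → Set ℤ := fun j => Set.Icc (-((j / p : ℕ) : ℤ)) 0
  have hB : ∀ j, (B j).Finite := fun j => Set.finite_Icc _ _
  have hcard : ∀ j, ((B j).ncard : ℚ) = ((j / p : ℕ) : ℚ) + 1 := by
    intro j
    have : (B j).ncard = j / p + 1 := by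
      simp only [B]
      rw [← Finset.coe_Icc, Set.ncard_coe_finset, Int.card_Icc]
      generalize j / p = a
      omega
    rw [this]; push_cast; rfl
  have hmem : ∀ (j : ℕ) (t : ℤ), t ∈ B j ↔ t ≤ 0 ∧ -(p : ℤ) * t ≤ j := by
    intro j t
    have : -(p : ℤ) * t ≤ j ↔ -t ≤ (j : ℤ) / p := by
      rw [Int.le_ediv_iff_mul_le (by omega)]
      constructor <;> intro h <;> linarith
    rw [this]
    simp only [B, Set.mem_Icc]
    push_cast
    constructor <;> rintro ⟨h1, h2⟩ <;> exact ⟨by linarith, by linarith⟩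
  let F : (Fin m → ℕ) × ℤ → Fin (m + 1) → ℤ := fun v => Fin.cons v.2 fun i => (v.1 i : ℤ)
  have hF : Function.Injective F := by
    rintro ⟨z, a⟩ ⟨z', a'⟩ h
    obtain ⟨rfl, h2⟩ := Fin.cons_injective2 h
    have : z = z' := funext fun i => by exact_mod_cast congrFun h2 i
    rw [this]
  have hset : {z : Fin (m + 1) → ℤ | (fun j => (z j : ℝ)) ∈ (k : ℝ) • simplexS p m} =
      F '' {v | ∑ i, v.1 i ≤ k ∧ v.2 ∈ B (k - ∑ i, v.1 i)} := by
    ext z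
    rw [simplexS_eq_hrepS hp, Set.mem_ofPred_eq, mem_smul_hrepS hk]
    constructor
    · rintro ⟨h0, h1, h2⟩
      lift Fin.tail z to Fin m → ℕ using h1 with w hw
      have hw' : ∀ i : Fin m, z i.succ = w i := fun i => (congrFun hw i).symm
      simp only [hw'] at h2
      have h3 : 0 ≤ -(p : ℤ) * z 0 := by nlinarith
      have h4 : ∑ i, w i ≤ k := by zify; linarith
      refine ⟨(w, z 0), ⟨h4, (hmem _ _).mpr ⟨h0, ?_⟩⟩, ?_⟩
      · push_cast [Nat.cast_sub h4]; linarith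
      · conv_rhs => rw [← Fin.cons_self_tail z]
        exact congrArg (fun t : Fin m → ℤ => (Fin.cons (z 0) t : Fin (m + 1) → ℤ)) hw
    · rintro ⟨⟨w, a⟩, ⟨h1, h2⟩, rfl⟩
      obtain ⟨h3, h4⟩ := (hmem _ _).mp h2
      push_cast [Nat.cast_sub h1] at h4
      refine ⟨h3, fun i => Int.natCast_nonneg _, ?_⟩
      simp only [F, Fin.cons_zero, Fin.cons_succ]
      linarith
  rw [latticeCount, hset, Set.ncard_image_of_injective _ hF, (ncard_simplex_fibration hB m k).2]
  simp only [hcard]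

theorem latticeCount_polytopeH {p : ℕ} (hp : 1 ≤ p) (m : ℕ) {k : ℕ} (hk : 1 ≤ k) :
    (latticeCount ((k : ℝ) • polytopeH p m) : ℚ) =
      iterSum m (fun j => ((sliceH p k j).ncard : ℚ)) k := by
  -- The fibration lemma asks for finite fibres at every `j`, while finiteness of the slice is
  -- available for `j ≤ k`; the values beyond `k` never occur.
  let B : ℕ → Set (ℤ × ℤ) := fun j => if j ≤ k then sliceH p k j else ∅
  have hB : ∀ j, (B j).Finite := fun j => by
    by_cases h : j ≤ k
    · simpa [B, h] using (finite_and_ncard_sliceH hp (by omega) (by omega)).1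
    · simp [B, h]
  let F : (Fin m → ℕ) × (ℤ × ℤ) → Fin (m + 2) → ℤ := fun v =>
    Fin.cons v.2.1 (Fin.cons v.2.2 fun i => (v.1 i : ℤ) : Fin (m + 1) → ℤ)
  have hF : Function.Injective F := by
    rintro ⟨z, a, b⟩ ⟨z', a', b'⟩ h
    obtain ⟨rfl, h1⟩ := Fin.cons_injective2 h
    obtain ⟨rfl, h2⟩ := Fin.cons_injective2 h1
    have : z = z' := funext fun i => by exact_mod_cast congrFun h2 i
    rw [this]
  have hset : {z : Fin (m + 2) → ℤ | (fun j => (z j : ℝ)) ∈ (k : ℝ) • polytopeH p m} =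
      F '' {v | ∑ i, v.1 i ≤ k ∧ v.2 ∈ B (k - ∑ i, v.1 i)} := by
    ext z
    rw [(polytopeH_eq hp m).1, Set.mem_ofPred_eq, mem_smul_hrepH hk]
    constructor
    · rintro ⟨h1, h2, h3⟩
      lift Fin.tail (Fin.tail z) to Fin m → ℕ using h1 with w hw
      have hw' : ∀ i : Fin m, z i.succ.succ = w i := fun i => (congrFun hw i).symm
      simp only [hw'] at h2 h3
      have h4 : ∑ i, w i ≤ k := by zify; linarith
      refine ⟨(w, z 0, z 1), ⟨h4, ?_⟩, ?_⟩
      · simp only [B, Nat.sub_le, if_true]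
        push_cast [Nat.cast_sub h4]
        exact h3
      · simp only [F]
        rw [hw]
        have h5 : z 1 = Fin.tail z 0 := rfl
        rw [h5, Fin.cons_self_tail, Fin.cons_self_tail]
    · rintro ⟨⟨w, a, b⟩, ⟨h1, h2⟩, rfl⟩
      simp only [B, Nat.sub_le, if_true] at h2
      push_cast [Nat.cast_sub h1] at h2
      refine ⟨fun i => Int.natCast_nonneg _, ?_, h2⟩
      simp only [F, Fin.cons_succ]
      exact_mod_cast h1
  rw [latticeCount, hset, Set.ncard_image_of_injective _ hF, (ncard_simplex_fibration hB m k).2]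
  exact iterSum_congr m fun j hj => by simp [B, hj]

/-- `ehr_{H_n}(k) - 2 q k ehr_{S_n}(k)` is a polynomial of degree at most `n`. -/
theorem exists_polynomial_latticeCount_polytopeH {p : ℕ} (hp : 1 ≤ p) (m : ℕ) :
    ∃ r : ℚ[X], r.natDegree ≤ m + 2 ∧ ∀ k : ℕ, 1 ≤ k →
      (latticeCount ((k : ℝ) • polytopeH p m) : ℚ) =
        2 * qOf p * k * iterSum m (fun j => ((j / p : ℕ) : ℚ) + 1) k + r.eval (k : ℚ) := by
  obtain ⟨R0, hR0, hR0e⟩ := exists_polynomial_iterSum m (Polynomial.X ^ 0) (d := 0) (by simp)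
  obtain ⟨R1, hR1, hR1e⟩ := exists_polynomial_iterSum m (Polynomial.X ^ 1) (d := 1) (by simp)
  obtain ⟨R2, hR2, hR2e⟩ := exists_polynomial_iterSum m (Polynomial.X ^ 2) (d := 2) (by simp)
  simp only [Polynomial.eval_pow, Polynomial.eval_X] at hR0e hR1e hR2e
  let q : ℚ := qOf p
  let κ₂ : ℚ := 2 * p * (p - 1) * (p - 2) - (p + 1) * (p - 2) ^ 2 - (p - 3) - (q - 1) ^ 2
  let κ₁ : ℚ := -(p * (p - 2)) - (p - 1)
  -- The term `2qk` of `(qk + 1)²` is missing here: it supplies the `+ 1` in `2qk(⌊j/p⌋ + 1)`.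
  let A0 : ℚ[X] := Polynomial.C (q ^ 2) * Polynomial.X ^ 2 + Polynomial.C 0 * Polynomial.X +
    Polynomial.C 1
  let A1 : ℚ[X] := Polynomial.C (2 * q ^ 2) * Polynomial.X + Polynomial.C (q + κ₁)
  have hA0 : A0.natDegree ≤ 2 := Polynomial.natDegree_quadratic_le
  have hA1 : A1.natDegree ≤ 1 := Polynomial.natDegree_linear_le
  refine ⟨A0 * R0 + A1 * R1 + Polynomial.C κ₂ * R2, ?_, fun k hk => ?_⟩
  · refine Polynomial.natDegree_add_le_of_degree_le (Polynomial.natDegree_add_le_of_degree_le ?_ ?_)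
      ((Polynomial.natDegree_C_mul_le _ _).trans (by omega))
    · exact Polynomial.natDegree_mul_le.trans (by omega)
    · exact Polynomial.natDegree_mul_le.trans (by omega)
  · have hslice : ∀ j ≤ k, ((sliceH p k j).ncard : ℚ) =
        2 * q * k * (((j / p : ℕ) : ℚ) + 1) + (A0.eval (k : ℚ) * (j : ℚ) ^ 0 +
          (A1.eval (k : ℚ) * (j : ℚ) ^ 1 + κ₂ * (j : ℚ) ^ 2)) := by
      intro j hj
      have := (finite_and_ncard_sliceH hp (k := k) (j := j) (by omega) (by omega)).2
      have h2 : (((sliceH p k j).ncard : ℤ) : ℚ) = _ := congrArg (Int.cast : ℤ → ℚ) this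
      rw [← Int.natCast_ediv] at h2
      push_cast [-Int.natCast_ediv] at h2
      rw [h2]
      simp only [A0, A1, κ₁, κ₂, q, Polynomial.eval_add, Polynomial.eval_mul, Polynomial.eval_C,
        Polynomial.eval_X, Polynomial.eval_pow]
      ring
    rw [latticeCount_polytopeH hp m hk, iterSum_congr m hslice, iterSum_add, iterSum_add,
      iterSum_add, iterSum_const_mul, iterSum_const_mul, iterSum_const_mul, iterSum_const_mul,
      hR0e, hR1e, hR2e]
    simp only [Polynomial.eval_add, Polynomial.eval_mul, Polynomial.eval_C, q]
    ring

/-! ### Coefficient functions and the conclusion -/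

theorem isMinPeriod_const (a : ℚ) : IsMinPeriod (fun _ => a) 1 :=
  ⟨⟨one_pos, fun _ => rfl⟩, fun _ ht => ht.1⟩

theorem IsMinPeriod.const_add_const_mul {h : ℤ → ℚ} {T : ℕ} (hh : IsMinPeriod h T) (a : ℚ) {b : ℚ}
    (hb : b ≠ 0) : IsMinPeriod (fun x => a + b * h x) T := by
  refine ⟨⟨hh.1.1, fun x => ?_⟩, fun t ⟨ht, hper⟩ => hh.2 ⟨ht, fun x => ?_⟩⟩
  · simp only [hh.1.2 x]
  · have := hper x
    simpa [hb] using this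

/-- The coefficient functions of a quasi-polynomial `r(x) + b h(x) x^l`. -/
def quasiCoeff (d l : ℕ) (r : ℚ[X]) (b : ℚ) (h : ℤ → ℚ) (i : Fin (d + 1)) (x : ℤ) : ℚ :=
  if (i : ℕ) = l then r.coeff i + b * h x else r.coeff i

theorem sum_quasiCoeff {d l : ℕ} (hl : l ≤ d) {r : ℚ[X]} (hr : r.natDegree ≤ d) (b : ℚ)
    (h : ℤ → ℚ) (x : ℤ) :
    ∑ i : Fin (d + 1), quasiCoeff d l r b h i x * (x : ℚ) ^ (i : ℕ) =
      r.eval (x : ℚ) + b * h x * (x : ℚ) ^ l := by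
  have : ∀ i : Fin (d + 1), quasiCoeff d l r b h i x * (x : ℚ) ^ (i : ℕ) =
      r.coeff i * (x : ℚ) ^ (i : ℕ) + if (i : ℕ) = l then b * h x * (x : ℚ) ^ (i : ℕ) else 0 := by
    intro i
    unfold quasiCoeff
    split_ifs <;> ring
  rw [Finset.sum_congr rfl fun i _ => this i, Finset.sum_add_distrib,
    Fin.sum_univ_eq_sum_range (fun i => r.coeff i * (x : ℚ) ^ i),
    Fin.sum_univ_eq_sum_range (fun i => if i = l then b * h x * (x : ℚ) ^ i else 0),
    ← Polynomial.eval_eq_sum_range' (Nat.lt_succ_of_le hr), Finset.sum_ite_eq' ,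
    if_pos (Finset.mem_range.mpr (Nat.lt_succ_of_le hl))]

theorem isMinPeriod_quasiCoeff {d l : ℕ} (r : ℚ[X]) {b : ℚ} (hb : b ≠ 0) {h : ℤ → ℚ} {T : ℕ}
    (hh : IsMinPeriod h T) (i : Fin (d + 1)) :
    IsMinPeriod (quasiCoeff d l r b h i) (if (i : ℕ) = l then T else 1) := by
  unfold quasiCoeff
  split_ifs
  · exact hh.const_add_const_mul _ hb
  · exact isMinPeriod_const _

theorem isEhrhartCoeff_quasiCoeff {d l : ℕ} (hl : l ≤ d) {K : Set (Fin d → ℝ)} {r : ℚ[X]}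
    (hr : r.natDegree ≤ d) {b : ℚ} (hb : b ≠ 0) {h : ℤ → ℚ} {T : ℕ} (hh : IsMinPeriod h T)
    (hK : ∀ k : ℕ, 1 ≤ k → (latticeCount ((k : ℝ) • K) : ℚ) =
      r.eval (k : ℚ) + b * h k * (k : ℚ) ^ l) :
    IsEhrhartCoeff K (quasiCoeff d l r b h) where
  periodic i := ⟨_, (isMinPeriod_quasiCoeff r hb hh i).1⟩
  count k hk := by
    rw [hK k hk]
    exact_mod_cast (sum_quasiCoeff hl hr b h k).symm

theorem mainTheorem1 (p : ℕ) (hp : 1 ≤ p) (m : ℕ) :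
    IsFoldPyramid (segmentL p) m (simplexS p m) ∧
    IsFoldPyramid (pentagon p) m (pyramidP p m) ∧
    IsConvexRationalPolytope (polytopeH p m) ∧
    affineDim (polytopeH p m) = m + 2 ∧
    HasPeriodSequence (polytopeH p m) (fun i => if (i : ℕ) = 1 then p else 1) ∧
    ∃ f g : ℤ → ℚ,
      IsEhrhartQuasiPolynomial (polytopeH p m) f ∧
      IsEhrhartQuasiPolynomial (simplexS p m) g ∧
      EquivModPoly f (fun x => 2 * (qOf p : ℚ) * (x : ℚ) * g x) := by
  obtain ⟨r, h, hr, hh, hrh⟩ := exists_iterSum_floor p hp m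
  obtain ⟨R, hR, hRe⟩ := exists_polynomial_latticeCount_polytopeH hp m
  have hq : (2 * qOf p : ℚ) ≠ 0 := by
    have := one_le_qOf hp
    have : (1 : ℚ) ≤ qOf p := by exact_mod_cast this
    positivity
  have hRr : (Polynomial.C (2 * qOf p : ℚ) * Polynomial.X * r + R).natDegree ≤ m + 2 := by
    refine Polynomial.natDegree_add_le_of_degree_le ?_ hR
    rw [mul_assoc]
    refine (Polynomial.natDegree_C_mul_le _ _).trans (Polynomial.natDegree_mul_le.trans ?_)
    rw [Polynomial.natDegree_X]
    omega
  -- The same periodic `h` sits in degree `1` for `H_n`, with factor `2q`, and in degree `0` for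
  -- `S_n`, with factor `1`. Its contributions therefore cancel in the difference at every integer,
  -- negative ones included, leaving the polynomial `R`.
  have hH := isEhrhartCoeff_quasiCoeff (K := polytopeH p m) (l := 1) (by omega) hRr hq hh
    fun k hk => by
      rw [hRe k hk, hrh]
      simp only [Polynomial.eval_add, Polynomial.eval_mul, Polynomial.eval_C, Polynomial.eval_X]
      ring
  have hS := isEhrhartCoeff_quasiCoeff (K := simplexS p m) (l := 0) (by omega) hr one_ne_zero hh
    fun k hk => by rw [latticeCount_simplexS hp m hk, hrh]; ring
  refine ⟨isFoldPyramid_simplexS hp m, isFoldPyramid_pyramidP p m,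
    isConvexRationalPolytope_polytopeH hp m, affineDim_polytopeH hp m,
    ⟨_, hH, isMinPeriod_quasiCoeff _ hq hh⟩, _, _, ⟨_, hH, fun x => rfl⟩, ⟨_, hS, fun x => rfl⟩,
    R, fun x => ?_⟩
  dsimp only
  rw [sum_quasiCoeff (by omega) hRr, sum_quasiCoeff (by omega) hr]
  simp only [Polynomial.eval_add, Polynomial.eval_mul, Polynomial.eval_C, Polynomial.eval_X]
  ring
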